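/- Let $n\ge 1$ and let $x=(x_1,\dots,x_n)$, $y=(y_1,\dots,y_n)$ be two independent sets of variables; write $y^2=(y_1^2,\dots,y_n^2)$. Let $\mathscr P^{(n)}$ be the set of partitions of length at most $n$ and $\widetilde{\mathscr P}^{(n)}$ the set of partitions all of whose parts are at most $n$; put $\Delta=(n,n-1,\dots,1)$ and $\delta=(n-1,\dots,1,0)$. For partitions $\eta,\zeta$ let $\eta\cup\zeta$ be the partition whose multiplicities are the sums of those of $\eta$ and $\zeta$, and let $\lambda'$ be the conjugate of $\lambda$. For $\alpha\in(\mathbb Z_{\ge0})^n$ let $a_\alpha=\sum_{\sigma\in\mathfrak S_n}\mathrm{sgn}(\sigma)\,\sigma(x^\alpha)$, let $s_\lambda=a_{\lambda+\delta}/a_\delta$ ($\lambda\in\mathscr P^{(n)}$) be the Schur polynomials in $n$ variables over $\mathbb Q$, and let $c^\lambda_{\mu\nu}$ be the Littlewood--Richardson coefficients, $s_\mu s_\nu=\sum_{\lambda\in\mathscr P^{(n)}}c^\lambda_{\mu\nu}s_\lambda$. Let $e_\xi=e_{\xi_1}e_{\xi_2}\cdots$ ($\xi\in\widetilde{\mathscr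 P}^{(n)}$) be the elementary symmetric polynomials. Let $K=(K_{\lambda\mu})$, indexed by all partitions, be the Kostka matrix ($K_{\lambda\mu}$ is the coefficient of the monomial symmetric polynomial $m_\mu$ in the Schur polynomial $s_\lambda$ in sufficiently many variables; it vanishes unless $|\lambda|=|\mu|$), and let $K^{-1}=(K^{-1}_{\lambda\mu})$ be its inverse. Define $q_r(x)$ by $\sum_{r\ge0}q_r(x)t^r=\prod_{i=1}^n\frac{1+x_it}{1-x_it}$, with $q_r(x)=0$ for $r<0$, and $S_\lambda(x)=\det\bigl(q_{\lambda_i-i+j}(x)\bigr)_{1\le i,j\le n}$ for $\lambda\in\mathscr P^{(n)}$. Let $A_n$ be the set of sequences $u=(u_1,\dots,u_n)$ of $n$ distinct non-negative integers. For $u\in A_n$ let $\tau_u\in\mathfrak S_n$ be the unique permutation with $u_{\tau_u(1)}>u_{\tau_u(2)}>\dots>u_{\tau_u(n)}$, and let $\tau_u^{-1}u-\delta\in\mathscr P^{(n)}$ be the partition with $i$-th part $u_{\tau_u(i)}-(n-i)$. Then the following identities hold between formal power series in $y$ with coefficients in $\mathbb Q[x]$. In both of them the sums over $\mu,\nu$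 (for fixed $\lambda$), over $u,v$ (for fixed $\xi$), and over $\eta,\zeta$ have only finitely many nonzero terms, and the sums over $\lambda$ and $\xi$ converge as formal power series: \begin{align*} &\sum_{\lambda\in\mathscr P^{(n)}}s_\lambda(y^2)\sum_{\mu,\nu\in\mathscr P^{(n)}}c^\lambda_{\mu\nu}S_{2\mu+\Delta}(x)S_{2\nu+\Delta}(x)\\ &=\sum_{\xi\in\widetilde{\mathscr P}^{(n)}}e_\xi(y^2)\sum_{u,v\in A_n}\mathrm{sgn}(\tau_u)\,\mathrm{sgn}(\tau_v)\left(\prod_{j=1}^nq_{2u_j+1-(n-j)}(x)\,q_{2v_j+1-(n-j)}(x)\right)\sum_{\substack{\eta,\zeta\in\widetilde{\mathscr P}^{(n)}\\\eta\cup\zeta=\xi}}K^{-1}_{\eta\,(\tau_u^{-1}u-\delta)'}\,K^{-1}_{\zeta\,(\tau_v^{-1}v-\delta)'}, \end{align*} \begin{align*} &\sum_{\lambda\in\mathscr P^{(n)}}s_\lambda(y^2)\sum_{\mu,\nu\in\mathscr P^{(n)}}c^\lambda_{\mu\nu}S_{2\mu+\delta}(x)S_{2\nu+\Delta}(x)\\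 &=\sum_{\xi\in\widetilde{\mathscr P}^{(n)}}e_\xi(y^2)\sum_{u,v\in A_n}\mathrm{sgn}(\tau_u)\,\mathrm{sgn}(\tau_v)\left(\prod_{j=1}^nq_{2u_j-(n-j)}(x)\,q_{2v_j+1-(n-j)}(x)\right)\sum_{\substack{\eta,\zeta\in\widetilde{\mathscr P}^{(n)}\\\eta\cup\zeta=\xi}}K^{-1}_{\eta\,(\tau_u^{-1}u-\delta)'}\,K^{-1}_{\zeta\,(\tau_v^{-1}v-\delta)'}. \end{align*} -/

import Mathlib

open scoped BigOperators

/-! ### Partitions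

A partition is a Young diagram: `mu.rowLen i` is the part with (0-based) index `i`,
`mu.colLen 0` is the length, `mu.rowLen 0` the largest part, `mu.rowLens` the list of the nonzero
parts, `mu.card` the size and `mu.transpose` the conjugate. -/

/-- The partitions of length at most `n`. -/
abbrev ParLen (n : ℕ) : Type := {mu : YoungDiagram // mu.colLen 0 ≤ n}

/-- The partitions whose parts are all at most `n`. -/
abbrev ParPart (n : ℕ) : Type := {mu : YoungDiagram // mu.rowLen 0 ≤ n}

/-- The partitions of size `k`. -/
abbrev ParSize (k : ℕ) : Type := {mu : YoungDiagram // mu.card = k}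

theorem YoungDiagram.colLen_le_card (mu : YoungDiagram) : mu.colLen 0 ≤ mu.card := by
  rw [YoungDiagram.colLen_eq_card]
  exact Finset.card_le_card (Finset.filter_subset _ _)

theorem YoungDiagram.rowLen_le_card (mu : YoungDiagram) : mu.rowLen 0 ≤ mu.card := by
  rw [YoungDiagram.rowLen_eq_card]
  exact Finset.card_le_card (Finset.filter_subset _ _)

theorem YoungDiagram.mem_lt_card (mu : YoungDiagram) {c : ℕ × ℕ} (hc : c ∈ mu.cells) :
    c.1 < mu.card ∧ c.2 < mu.card := by
  have hc' : (c.1, c.2) ∈ mu := hc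
  constructor
  · have h := YoungDiagram.mem_iff_lt_colLen.1 hc'
    exact lt_of_lt_of_le h ((mu.colLen_anti 0 c.2 (Nat.zero_le _)).trans mu.colLen_le_card)
  · have h := YoungDiagram.mem_iff_lt_rowLen.1 hc'
    exact lt_of_lt_of_le h ((mu.rowLen_anti 0 c.1 (Nat.zero_le _)).trans mu.rowLen_le_card)

instance ParSize.instFinite (k : ℕ) : Finite (ParSize k) := by
  have hf : Finite {s : Finset (ℕ × ℕ) // s ∈ (Finset.range k ×ˢ Finset.range k).powerset} :=
    inferInstance
  refine Finite.of_injective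
    (β := {s : Finset (ℕ × ℕ) // s ∈ (Finset.range k ×ˢ Finset.range k).powerset})
    (fun mu => ⟨mu.1.cells, ?_⟩) ?_
  · rw [Finset.mem_powerset]
    intro c hc
    have h := mu.1.mem_lt_card hc
    rw [mu.2] at h
    simpa [Finset.mem_product] using h
  · intro mu nu h
    apply Subtype.ext
    apply YoungDiagram.ext
    simpa using congrArg Subtype.val h

noncomputable instance ParSize.instFintype (k : ℕ) : Fintype (ParSize k) := Fintype.ofFinite _

noncomputable instance ParSize.instDecidableEq (k : ℕ) : DecidableEq (ParSize k) :=
  Classical.decEq _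

/-- `IsUnion eta zeta xi` says `eta ∪ zeta = xi`: the multiplicity of every `i` in `xi` is the sum of
its multiplicities in `eta` and `zeta`. -/
def IsUnion (eta zeta xi : YoungDiagram) : Prop :=
  ∀ i : ℕ, xi.rowLens.count i = eta.rowLens.count i + zeta.rowLens.count i

/-- The staircase `δ = (n - 1, …, 1, 0)`. -/
def stairZero (n : ℕ) (i : Fin n) : ℕ := n - 1 - (i : ℕ)

/-- The staircase `Δ = (n, …, 2, 1)`. -/
def stairOne (n : ℕ) (i : Fin n) : ℕ := n - (i : ℕ)

noncomputable section

/-! ### Schur polynomials -/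

/-- `a_α = ∑_σ sgn(σ) σ(x^α)`, where `σ` permutes the variables. -/
def alternant (n : ℕ) (al : Fin n → ℕ) : MvPolynomial (Fin n) ℚ :=
  ∑ σ : Equiv.Perm (Fin n),
    ((Equiv.Perm.sign σ : ℤˣ) : ℤ) •
      MvPolynomial.rename σ (∏ i : Fin n, (MvPolynomial.X i : MvPolynomial (Fin n) ℚ) ^ al i)

theorem alternant_eq_det (n : ℕ) (al : Fin n → ℕ) :
    alternant n al =
      (Matrix.of fun i j : Fin n => (MvPolynomial.X i : MvPolynomial (Fin n) ℚ) ^ al j).det := by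
  rw [Matrix.det_apply]
  unfold alternant
  refine Finset.sum_congr rfl fun σ _ => ?_
  simp [Units.smul_def]

theorem alternant_stair_dvd (n : ℕ) (al : Fin n → ℕ) :
    alternant n (stairZero n) ∣ alternant n al := by
  classical
  set P : Polynomial (MvPolynomial (Fin n) ℚ) :=
    ∏ i : Fin n, (Polynomial.X - Polynomial.C (MvPolynomial.X i)) with hP
  have hmonic : P.Monic := Polynomial.monic_prod_of_monic _ _ fun i _ => Polynomial.monic_X_sub_C _
  have hdeg : P.natDegree = n := by
    rw [hP, Polynomial.natDegree_prod_of_monic _ _ fun i _ => Polynomial.monic_X_sub_C _]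
    simp
  have hroot : ∀ i : Fin n, P.eval (MvPolynomial.X i) = 0 := by
    intro i
    rw [hP, Polynomial.eval_prod]
    exact Finset.prod_eq_zero (Finset.mem_univ i) (by simp)
  have key : ∀ (i : Fin n) (a : ℕ), (MvPolynomial.X i : MvPolynomial (Fin n) ℚ) ^ a =
      ∑ k : Fin n, MvPolynomial.X i ^ stairZero n k *
        ((Polynomial.X ^ a : Polynomial (MvPolynomial (Fin n) ℚ)) %ₘ P).coeff (stairZero n k) := by
    intro i a
    have hlt : ((Polynomial.X ^ a : Polynomial (MvPolynomial (Fin n) ℚ)) %ₘ P).natDegree < n := by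
      have hn : n ≠ 0 := fun h => (Fin.cast h i).elim0
      have h1 : P ≠ 1 := fun h => by
        rw [h] at hdeg
        exact hn (by simpa using hdeg.symm)
      have := Polynomial.natDegree_modByMonic_lt
        (Polynomial.X ^ a : Polynomial (MvPolynomial (Fin n) ℚ)) hmonic h1
      omega
    have h2 : (MvPolynomial.X i : MvPolynomial (Fin n) ℚ) ^ a =
        ((Polynomial.X ^ a : Polynomial (MvPolynomial (Fin n) ℚ)) %ₘ P).eval
          (MvPolynomial.X i) := by
      have h3 := congrArg (Polynomial.eval (MvPolynomial.X i : MvPolynomial (Fin n) ℚ))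
        (Polynomial.modByMonic_add_div
          (Polynomial.X ^ a : Polynomial (MvPolynomial (Fin n) ℚ)) P)
      rw [Polynomial.eval_add, Polynomial.eval_mul, hroot i, zero_mul, add_zero] at h3
      simpa using h3.symm
    rw [h2, Polynomial.eval_eq_sum_range' hlt, Finset.sum_range, ← Equiv.sum_comp Fin.revPerm]
    refine Finset.sum_congr rfl fun k _ => ?_
    have hk : ((Fin.revPerm k : Fin n) : ℕ) = stairZero n k := by
      simp only [Fin.revPerm_apply, Fin.val_rev, stairZero]
      omega
    rw [hk, mul_comm]
  rw [alternant_eq_det, alternant_eq_det]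
  have hmul : (Matrix.of fun i j : Fin n => (MvPolynomial.X i : MvPolynomial (Fin n) ℚ) ^ al j) =
      (Matrix.of fun i j : Fin n => (MvPolynomial.X i : MvPolynomial (Fin n) ℚ) ^ stairZero n j) *
      (Matrix.of fun k j : Fin n =>
        ((Polynomial.X ^ al j : Polynomial (MvPolynomial (Fin n) ℚ)) %ₘ P).coeff
          (stairZero n k)) := by
    ext1 i j
    rw [Matrix.mul_apply]
    exact key i (al j)
  rw [hmul, Matrix.det_mul]
  exact dvd_mul_right _ _

/-- The Schur polynomial `s_λ = a_{λ+δ} / a_δ` in `n` variables, for `λ` of length at most `n`. -/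
def schur (n : ℕ) (mu : ParLen n) : MvPolynomial (Fin n) ℚ :=
  (alternant_stair_dvd n fun i => mu.1.rowLen i + stairZero n i).choose

theorem alternant_eq_mul_schur (n : ℕ) (mu : ParLen n) :
    alternant n (fun i => mu.1.rowLen i + stairZero n i) =
      alternant n (stairZero n) * schur n mu :=
  (alternant_stair_dvd n fun i => mu.1.rowLen i + stairZero n i).choose_spec

/-- The Littlewood--Richardson coefficient `c^λ_{μν}`: the coordinates of `s_μ s_ν` in the basis of
Schur polynomials `s_λ` (`l(λ) ≤ n`) of the space of symmetric polynomials in `n` variables. -/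
def lrCoeff (n : ℕ) (lam mu nu : ParLen n) : ℚ :=
  (Classical.epsilon fun c : ParLen n →₀ ℚ =>
    schur n mu * schur n nu = Finsupp.linearCombination ℚ (schur n) c) lam

/-! ### The (inverse) Kostka matrix -/

/-- The Kostka number `K_{λμ}` computed in `n` variables, for `λ, μ` of length at most `n`: the
coefficient of the monomial symmetric polynomial `m_μ` in `s_λ`, that is, the coefficient of the
monomial `x^μ` in `s_λ`. It does not depend on `n`. -/
def kostka (n : ℕ) (lam mu : ParLen n) : ℚ :=
  MvPolynomial.coeff (Finsupp.equivFunOnFinite.symm fun i : Fin n => mu.1.rowLen i) (schur n lam)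

/-- The block of the Kostka matrix that is indexed by the partitions of `k` (all of which have
length at most `k`). The Kostka matrix is the direct sum of these blocks. -/
def kostkaBlock (k : ℕ) : Matrix (ParSize k) (ParSize k) ℚ :=
  Matrix.of fun lam mu =>
    kostka k ⟨lam.1, lam.1.colLen_le_card.trans lam.2.le⟩
      ⟨mu.1, mu.1.colLen_le_card.trans mu.2.le⟩

open Classical in
/-- The entry `K⁻¹_{λμ}` of the inverse of the Kostka matrix, indexed by all partitions. -/
def invKostka (lam mu : YoungDiagram) : ℚ :=
  if h : lam.card = mu.card then (kostkaBlock mu.card)⁻¹ ⟨lam, h⟩ ⟨mu, rfl⟩ else 0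

/-! ### Elementary symmetric polynomials, `q_r` and the 2-reduced Schur polynomials -/

/-- The elementary symmetric polynomial `e_ξ = e_{ξ_1} e_{ξ_2} ⋯`. -/
def elemSymm (n : ℕ) (xi : ParPart n) : MvPolynomial (Fin n) ℚ :=
  (xi.1.rowLens.map fun r => MvPolynomial.esymm (Fin n) ℚ r).prod

/-- `q_r`: the coefficient of `t^r` in `∏_i (1 + x_i t)(1 + x_i t + x_i² t² + ⋯)`; it is `0` for
negative `r`. -/
def qPoly (n : ℕ) (r : ℤ) : MvPolynomial (Fin n) ℚ :=
  if 0 ≤ r then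
    PowerSeries.coeff r.toNat
      (∏ i : Fin n,
        ((1 + PowerSeries.C (MvPolynomial.X i) * PowerSeries.X) *
          PowerSeries.mk fun k => (MvPolynomial.X i : MvPolynomial (Fin n) ℚ) ^ k))
  else 0

/-- The 2-reduced Schur polynomial `S_α = det (q_{α_i - i + j})`. -/
def redSchur (n : ℕ) (al : Fin n → ℕ) : MvPolynomial (Fin n) ℚ :=
  (Matrix.of fun i j : Fin n => qPoly n ((al i : ℤ) - (i : ℤ) + (j : ℤ))).det

/-! ### The index set `A_n` -/

/-- `A_n`: sequences of `n` distinct non-negative integers. -/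
abbrev DistinctSeq (n : ℕ) : Type := {u : Fin n → ℕ // Function.Injective u}

/-- The permutation `τ_u` with `u ∘ τ_u` strictly decreasing. -/
def sortPerm {n : ℕ} (u : DistinctSeq n) : Equiv.Perm (Fin n) :=
  Tuple.sort fun i => OrderDual.toDual (u.1 i)

theorem strictAnti_sortPerm {n : ℕ} (u : DistinctSeq n) :
    StrictAnti fun i => u.1 (sortPerm u i) := by
  have h : Antitone fun i => u.1 (sortPerm u i) := fun i j hij =>
    Tuple.monotone_sort (fun i => OrderDual.toDual (u.1 i)) hij
  exact h.strictAnti_of_injective (u.2.comp (sortPerm u).injective)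

theorem antitone_sortPerm_sub {n : ℕ} (u : DistinctSeq n) :
    Antitone fun i => u.1 (sortPerm u i) - stairZero n i := by
  cases n with
  | zero => exact fun i => i.elim0
  | succ m =>
    rw [Fin.antitone_iff_succ_le]
    intro i
    have h : u.1 (sortPerm u i.succ) < u.1 (sortPerm u i.castSucc) :=
      strictAnti_sortPerm u Fin.castSucc_lt_succ
    simp only [stairZero, Fin.val_succ, Fin.val_castSucc]
    omega

/-- The partition `τ_u⁻¹ u - δ`, with parts `u_{τ_u(i)} - (n - i)`, `i = 1, …, n`. -/
def seqShape {n : ℕ} (u : DistinctSeq n) : YoungDiagram :=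
  YoungDiagram.ofRowLens (List.ofFn fun i => u.1 (sortPerm u i) - stairZero n i)
    (antitone_sortPerm_sub u).sortedGE_ofFn

/-- The sign of `τ_u`. -/
def seqSign {n : ℕ} (u : DistinctSeq n) : ℤ := ((Equiv.Perm.sign (sortPerm u) : ℤˣ) : ℤ)

/-! ### Formal power series in `y` with coefficients polynomials in `x` -/

/-- `f(y²) = f(y_1², …, y_n²)`, as a power series in `y` with coefficients in `ℚ[x]`. -/
def evalYSq (n : ℕ) (f : MvPolynomial (Fin n) ℚ) :
    MvPowerSeries (Fin n) (MvPolynomial (Fin n) ℚ) :=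
  ((MvPolynomial.map MvPolynomial.C (MvPolynomial.expand 2 f) :
      MvPolynomial (Fin n) (MvPolynomial (Fin n) ℚ)) :
    MvPowerSeries (Fin n) (MvPolynomial (Fin n) ℚ))

/-- The family `f` of power series in `y` over `ℚ[x]` is summable with sum `F` as a formal power
series: each coefficient is nonzero for only finitely many members of the family and these add up to
the coefficient of `F` (the coefficient ring is discrete). -/
def HasFormalSum {n : ℕ} {ι : Type} (f : ι → MvPowerSeries (Fin n) (MvPolynomial (Fin n) ℚ))
    (F : MvPowerSeries (Fin n) (MvPolynomial (Fin n) ℚ)) : Prop :=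
  letI : TopologicalSpace (MvPolynomial (Fin n) ℚ) := ⊥
  letI := MvPowerSeries.WithPiTopology.instTopologicalSpace (σ := Fin n) (MvPolynomial (Fin n) ℚ)
  HasSum f F

/-! ### The two sides -/

/-- The summand `c^λ_{μν} S_{2μ+D}(x) S_{2ν+E}(x)`. -/
def lrTerm (n : ℕ) (D E : Fin n → ℕ) (lam : ParLen n) (p : ParLen n × ParLen n) :
    MvPolynomial (Fin n) ℚ :=
  lrCoeff n lam p.1 p.2 •
    (redSchur n (fun i => 2 * p.1.1.rowLen i + D i) *
      redSchur n (fun i => 2 * p.2.1.rowLen i + E i))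

/-- `∑_{η ∪ ζ = ξ} K⁻¹_{η (τ_u⁻¹u-δ)'} K⁻¹_{ζ (τ_v⁻¹v-δ)'}`, a finite sum. -/
def invKostkaSum (n : ℕ) (xi : ParPart n) (u v : DistinctSeq n) : ℚ :=
  ∑ᶠ p : {p : ParPart n × ParPart n // IsUnion p.1.1 p.2.1 xi.1},
    invKostka p.1.1.1 (seqShape u).transpose * invKostka p.1.2.1 (seqShape v).transpose

/-- The summand for `(u, v)` of the coefficient of `e_ξ(y²)`, with the products of
`q_{2u_j+a-(n-j)}(x)` and `q_{2v_j+b-(n-j)}(x)`. -/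
def elemTerm (n : ℕ) (a b : ℤ) (xi : ParPart n) (p : DistinctSeq n × DistinctSeq n) :
    MvPolynomial (Fin n) ℚ :=
  (((seqSign p.1 * seqSign p.2 : ℤ) : ℚ) * invKostkaSum n xi p.1 p.2) •
    ∏ j : Fin n,
      (qPoly n (2 * (p.1.1 j : ℤ) + a - (stairZero n j : ℤ)) *
        qPoly n (2 * (p.2.1 j : ℤ) + b - (stairZero n j : ℤ)))

end

/-! Both sides expand one product of generating functions, (∑_μ S_{2μ+D}(x) s_μ(y²)) · (∑_ν
S_{2ν+E}(x) s_ν(y²)), where D and E are δ or Δ. Nothing about the q_r is needed beyond the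
determinantal form of S.

On the left, s_μ s_ν is expanded in Schur polynomials (`sum_lrTerm_eq`). On the right, two
expansions are made. Write D = δ + a with a ∈ {0, 1}. The (i, j) entry of the determinant S_{2μ+D}
is q with index 2(μ+δ)_i + a - δ_j, so its Leibniz expansion is a signed sum over the rearrangements
u of μ+δ. A pair (μ, σ) is the same thing as a sequence u ∈ A_n (`seqEquiv`), which turns the sum
over μ into a sum over u (`redSchur_eq_sum_seqWeight`, `sum_seqWeight_eq`). Then s_μ = ∑_η K⁻¹_{ημ'}
e_η is inserted, and e_η e_ζ = e_{η∪ζ} groups the terms by ξ (`sum_invKostkaSum`,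
`sum_elemTerm_eq`).

The expansion of s_μ inverts e_ξ = ∑_λ K_{λξ} s_{λ'}, a form of the dual Cauchy identity. This is
proved in `prod_esymm_eq_sum` by induction on the number of factors: the Pieri rule adds a vertical
strip to λ', the branching rule removes a horizontal strip from a partition, and conjugation
exchanges the two. The Kostka blocks are invertible because Schur polynomials are independent and a
symmetric polynomial is determined by its coefficients at partitions.

Littlewood–Richardson coefficients and inverse Kostka numbers respect sizes, so the identity splits
into finite identities, one in each degree in y. -/

namespace YoungDiagram

/-! ### Row lengths and sizes of Young diagrams. -/

theorem ext_rowLen {mu nu : YoungDiagram} (h : ∀ i, mu.rowLen i = nu.rowLen i) : mu = nu := by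
  ext ⟨i, j⟩
  rw [mem_cells, mem_cells, mem_iff_lt_rowLen, mem_iff_lt_rowLen, h]

theorem rowLen_eq_zero_iff {mu : YoungDiagram} {i : ℕ} : mu.rowLen i = 0 ↔ mu.colLen 0 ≤ i := by
  rw [← not_lt, ← mem_iff_lt_colLen, mem_iff_lt_rowLen]
  omega

theorem card_eq_sum_rowLen (mu : YoungDiagram) {N : ℕ} (h : mu.colLen 0 ≤ N) :
    mu.card = ∑ i ∈ Finset.range N, mu.rowLen i := by
  rw [YoungDiagram.card, Finset.card_eq_sum_card_fiberwise (f := Prod.fst) (t := Finset.range N)]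
  · refine Finset.sum_congr rfl fun i _ => ?_
    rw [rowLen_eq_card]
    rfl
  · intro c hc
    have hc' : (c.1, c.2) ∈ mu := hc
    have h1 := mem_iff_lt_colLen.1 hc'
    have h2 := mu.colLen_anti 0 c.2 (Nat.zero_le _)
    simp only [Finset.coe_range, Set.mem_Iio]
    omega

theorem card_transpose (mu : YoungDiagram) : mu.transpose.card = mu.card := by
  simp [YoungDiagram.card, transpose]

theorem rowLens_sum (mu : YoungDiagram) : mu.rowLens.sum = mu.card := by
  rw [mu.card_eq_sum_rowLen le_rfl, rowLens, Finset.sum_range, ← List.sum_ofFn]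
  congr 1
  rw [List.ofFn_eq_map, ← List.map_coe_finRange_eq_range, List.map_map]
  rfl

theorem rowLen_zero_le_iff {mu : YoungDiagram} {n : ℕ} :
    mu.rowLen 0 ≤ n ↔ ∀ r ∈ mu.rowLens, r ≤ n := by
  constructor
  · intro h r hr
    rw [rowLens, List.mem_map] at hr
    obtain ⟨i, -, rfl⟩ := hr
    exact (mu.rowLen_anti 0 i (Nat.zero_le _)).trans h
  · intro h
    by_cases h0 : mu.colLen 0 = 0
    · rw [rowLen_eq_zero_iff.2 h0.le]
      exact Nat.zero_le _
    · exact h _ (List.mem_map.2 ⟨0, List.mem_range.2 (Nat.pos_of_ne_zero h0), rfl⟩)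

end YoungDiagram

/-! ### Partitions of length at most n as strictly decreasing sequences. -/

namespace ParLen

variable {n : ℕ}

theorem ext_rowLen {mu nu : ParLen n} (h : ∀ i : Fin n, mu.1.rowLen i = nu.1.rowLen i) :
    mu = nu := by
  apply Subtype.ext
  apply YoungDiagram.ext_rowLen
  intro i
  by_cases hi : i < n
  · exact h ⟨i, hi⟩
  · rw [YoungDiagram.rowLen_eq_zero_iff.2 (mu.2.trans (not_lt.1 hi)),
      YoungDiagram.rowLen_eq_zero_iff.2 (nu.2.trans (not_lt.1 hi))]

theorem card_eq_sum (mu : ParLen n) : mu.1.card = ∑ i : Fin n, mu.1.rowLen i := by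
  rw [mu.1.card_eq_sum_rowLen mu.2, Finset.sum_range]

theorem antitone_rowLen (mu : ParLen n) : Antitone fun i : Fin n => mu.1.rowLen i :=
  fun _ _ hij => mu.1.rowLen_anti _ _ hij

/-- The partition of length at most `n` with the given parts. -/
def ofAntitone (al : Fin n → ℕ) (h : Antitone al) : ParLen n :=
  ⟨YoungDiagram.ofRowLens (List.ofFn al) h.sortedGE_ofFn, by
    by_contra hlt
    rw [not_le, ← YoungDiagram.mem_iff_lt_colLen, YoungDiagram.mem_ofRowLens] at hlt
    obtain ⟨h1, -⟩ := hlt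
    simp at h1⟩

@[simp]
theorem rowLen_ofAntitone (al : Fin n → ℕ) (h : Antitone al) (i : Fin n) :
    (ofAntitone al h).1.rowLen i = al i := by
  have := YoungDiagram.rowLen_ofRowLens (hw := h.sortedGE_ofFn) (i.cast (by simp))
  simpa [ofAntitone] using this

/-- The strictly decreasing sequence `mu + δ`. -/
def strictSeq (mu : ParLen n) (i : Fin n) : ℕ := mu.1.rowLen i + stairZero n i

theorem strictAnti_strictSeq (mu : ParLen n) : StrictAnti mu.strictSeq := by
  intro i j hij
  have h := mu.antitone_rowLen hij.le
  have h1 : (i : ℕ) < j := hij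
  have := j.2
  simp only [strictSeq, stairZero] at h ⊢
  omega

/-- There are n - 1 - i entries after position i, and each step towards the end loses at least one.
-/
theorem stairZero_le_of_strictAnti {al : Fin n → ℕ} (h : StrictAnti al) (i : Fin n) :
    stairZero n i ≤ al i := by
  have key : ∀ d : ℕ, ∀ i : Fin n, stairZero n i = d → d ≤ al i := by
    intro d
    induction d with
    | zero => intro i _; exact Nat.zero_le _
    | succ d ih =>
      intro i hi
      simp only [stairZero] at hi
      have := h (show i < ⟨i + 1, by omega⟩ from Nat.lt_succ_self _)
      have := ih ⟨i + 1, by omega⟩ (by simp only [stairZero]; omega)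
      omega
  exact key _ i rfl

theorem antitone_sub_of_strictAnti {al : Fin n → ℕ} (h : StrictAnti al) :
    Antitone fun i => al i - stairZero n i := by
  cases n with
  | zero => exact fun i => i.elim0
  | succ m =>
    rw [Fin.antitone_iff_succ_le]
    intro i
    have h : al i.succ < al i.castSucc := h Fin.castSucc_lt_succ
    simp only [stairZero, Fin.val_succ, Fin.val_castSucc]
    omega

/-- The partition `mu` such that `mu + δ` is the given strictly decreasing sequence. -/
def ofStrictAnti (al : Fin n → ℕ) (h : StrictAnti al) : ParLen n :=
  ofAntitone _ (antitone_sub_of_strictAnti h)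

@[simp]
theorem strictSeq_ofStrictAnti (al : Fin n → ℕ) (h : StrictAnti al) :
    (ofStrictAnti al h).strictSeq = al := by
  ext i
  have := stairZero_le_of_strictAnti h i
  simp only [strictSeq, ofStrictAnti, rowLen_ofAntitone]
  omega

theorem strictSeq_injective : Function.Injective (strictSeq (n := n)) := by
  intro mu nu h
  apply ext_rowLen
  intro i
  have := congrFun h i
  simp only [strictSeq] at this
  omega

theorem sum_strictSeq (mu : ParLen n) :
    ∑ i, mu.strictSeq i = mu.1.card + ∑ i, stairZero n i := by
  rw [card_eq_sum, ← Finset.sum_add_distrib]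
  rfl

/-- The shape of `u ∈ A_n`, as a partition of length at most `n`. -/
def ofSeq (u : DistinctSeq n) : ParLen n := ofStrictAnti _ (strictAnti_sortPerm u)

theorem coe_ofSeq (u : DistinctSeq n) : (ofSeq u).1 = seqShape u := rfl

theorem strictSeq_ofSeq (u : DistinctSeq n) (i : Fin n) :
    (ofSeq u).strictSeq i = u.1 (sortPerm u i) := by
  rw [ofSeq, strictSeq_ofStrictAnti]

theorem finite_card_eq (k : ℕ) : {mu : ParLen n | mu.1.card = k}.Finite := by
  refine Set.Finite.of_injOn (f := fun mu : ParLen n => mu.1)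
    (t := Subtype.val '' (Set.univ : Set (ParSize k))) ?_ ?_ (Set.toFinite _)
  · intro mu hmu
    exact ⟨⟨mu.1, hmu⟩, trivial, rfl⟩
  · exact fun _ _ _ _ h => Subtype.ext h

end ParLen

/-- A permutation is determined by the strictly decreasing rearrangement of an injective
sequence. -/
theorem strictAnti_comp_perm_unique {n : ℕ} {al be : Fin n → ℕ} (ha : StrictAnti al)
    (hb : StrictAnti be) (σ : Equiv.Perm (Fin n)) (h : al ∘ σ = be) : σ = 1 ∧ al = be := by
  have h1 : al = be := by
    have h2 : Set.range al = Set.range be := by rw [← h, σ.surjective.range_comp]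
    have ha' : StrictMono (al ∘ Fin.rev) := fun i j hij => ha (Fin.rev_lt_rev.2 hij)
    have hb' : StrictMono (be ∘ Fin.rev) := fun i j hij => hb (Fin.rev_lt_rev.2 hij)
    have h3 := (StrictMono.range_inj ha' hb').1 (by
      rw [Fin.rev_surjective.range_comp, Fin.rev_surjective.range_comp, h2])
    ext i
    simpa using congrFun h3 (Fin.rev i)
  refine ⟨?_, h1⟩
  ext i
  have h4 : al (σ i) = al i := by rw [h1] at h ⊢; exact congrFun h i
  rw [ha.injective h4]
  rfl

/-! ### Antisymmetrization and alternants. -/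

noncomputable section

open MvPolynomial

variable {n : ℕ}

/-- The antisymmetrization `∑_σ sgn(σ) σ(p)` of a polynomial. -/
def antisymmetrize (n : ℕ) : MvPolynomial (Fin n) ℚ →ₗ[ℚ] MvPolynomial (Fin n) ℚ :=
  ∑ σ : Equiv.Perm (Fin n),
    ((Equiv.Perm.sign σ : ℤˣ) : ℤ) • (rename (R := ℚ) σ).toLinearMap

theorem antisymmetrize_apply (p : MvPolynomial (Fin n) ℚ) :
    antisymmetrize n p = ∑ σ : Equiv.Perm (Fin n), ((Equiv.Perm.sign σ : ℤˣ) : ℤ) • rename σ p := by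
  simp [antisymmetrize, LinearMap.sum_apply]

theorem prod_X_pow_eq_monomial (al : Fin n → ℕ) :
    ∏ i : Fin n, (X i : MvPolynomial (Fin n) ℚ) ^ al i =
      monomial (Finsupp.equivFunOnFinite.symm al) 1 := by
  rw [monomial_eq, Finsupp.prod_fintype _ _ (by simp)]
  simp

theorem antisymmetrize_monomial (m : Fin n →₀ ℕ) (c : ℚ) :
    antisymmetrize n (monomial m c) = c • alternant n m := by
  have h : monomial m c = c • ∏ i : Fin n, (X i : MvPolynomial (Fin n) ℚ) ^ m i := by
    rw [prod_X_pow_eq_monomial, smul_monomial]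
    simp
  rw [h, map_smul, antisymmetrize_apply]
  rfl

theorem antisymmetrize_prod (al : Fin n → ℕ) :
    antisymmetrize n (∏ i : Fin n, (X i : MvPolynomial (Fin n) ℚ) ^ al i) = alternant n al := by
  rw [antisymmetrize_apply]
  rfl

/-- Linearity over symmetric polynomials reduces products with an alternant to computations with
monomials; both the Schur expansion and the Pieri rule rest on it. -/
theorem antisymmetrize_mul {f : MvPolynomial (Fin n) ℚ} (hf : f.IsSymmetric)
    (p : MvPolynomial (Fin n) ℚ) : antisymmetrize n (p * f) = antisymmetrize n p * f := by
  rw [antisymmetrize_apply, antisymmetrize_apply, Finset.sum_mul]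
  refine Finset.sum_congr rfl fun σ _ => ?_
  rw [map_mul, hf σ, smul_mul_assoc]

theorem alternant_comp_perm (al : Fin n → ℕ) (σ : Equiv.Perm (Fin n)) :
    alternant n (al ∘ σ) = ((Equiv.Perm.sign σ : ℤˣ) : ℤ) • alternant n al := by
  rw [alternant_eq_det, alternant_eq_det, zsmul_eq_mul, ← Matrix.det_permute']
  rfl

theorem alternant_eq_zero {al : Fin n → ℕ} (h : ¬ Function.Injective al) :
    alternant n al = 0 := by
  simp only [Function.Injective, not_forall] at h
  obtain ⟨i, j, hij, hne⟩ := h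
  rw [alternant_eq_det]
  refine Matrix.det_zero_of_column_eq hne fun k => ?_
  simp [hij]

theorem rename_alternant (al : Fin n → ℕ) (σ : Equiv.Perm (Fin n)) :
    rename σ (alternant n al) = ((Equiv.Perm.sign σ : ℤˣ) : ℤ) • alternant n al := by
  rw [alternant_eq_det, AlgHom.map_det, zsmul_eq_mul, ← Matrix.det_permute]
  congr 1
  ext1 i j
  simp

theorem isHomogeneous_alternant (al : Fin n → ℕ) :
    (alternant n al).IsHomogeneous (∑ i, al i) := by
  refine IsHomogeneous.sum _ _ _ fun σ _ => ?_
  rw [← mem_homogeneousSubmodule]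
  refine zsmul_mem ?_ _
  rw [mem_homogeneousSubmodule]
  refine IsHomogeneous.rename_isHomogeneous ?_
  exact IsHomogeneous.prod _ _ _ fun i _ => isHomogeneous_X_pow i (al i)

/-- The term of σ is the monomial with exponent α ∘ σ⁻¹, and only σ = 1 keeps a strictly decreasing
sequence strictly decreasing. -/
theorem coeff_alternant {al be : Fin n → ℕ} (ha : StrictAnti al) (hb : StrictAnti be) :
    coeff (Finsupp.equivFunOnFinite.symm be) (alternant n al) = if al = be then 1 else 0 := by
  have key : ∀ σ : Equiv.Perm (Fin n),
      rename σ (∏ i : Fin n, (X i : MvPolynomial (Fin n) ℚ) ^ al i) =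
        monomial (Finsupp.equivFunOnFinite.symm (al ∘ σ.symm)) 1 := by
    intro σ
    rw [← prod_X_pow_eq_monomial, map_prod, ← Equiv.prod_comp σ (fun i => X i ^ _)]
    simp
  simp only [alternant, coeff_sum, key, coeff_smul, coeff_monomial, EmbeddingLike.apply_eq_iff_eq]
  rw [Finset.sum_eq_single 1]
  · rw [← Equiv.Perm.inv_def]
    simp
  · intro σ _ hσ
    rw [if_neg, smul_zero]
    intro h
    apply hσ
    have := (strictAnti_comp_perm_unique ha hb σ⁻¹ h).1
    simpa using this
  · simp

theorem strictAnti_stairZero : StrictAnti (stairZero n) := by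
  intro i j hij
  have h1 : (i : ℕ) < j := hij
  have := j.2
  simp only [stairZero]
  omega

theorem alternant_stairZero_ne_zero : alternant n (stairZero n) ≠ 0 := by
  intro h
  have := coeff_alternant (n := n) strictAnti_stairZero strictAnti_stairZero
  simp [h] at this

/-! ### Schur polynomials as a basis of the symmetric polynomials. -/

theorem alternant_strictSeq (mu : ParLen n) :
    alternant n mu.strictSeq = alternant n (stairZero n) * schur n mu :=
  alternant_eq_mul_schur n mu

theorem alternant_distinctSeq (u : DistinctSeq n) :
    alternant n u.1 = alternant n (stairZero n) * (seqSign u • schur n (ParLen.ofSeq u)) := by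
  have h : u.1 ∘ sortPerm u = (ParLen.ofSeq u).strictSeq := by
    ext i
    rw [ParLen.strictSeq_ofSeq]
    rfl
  have h1 := alternant_comp_perm u.1 (sortPerm u)
  rw [h, alternant_strictSeq] at h1
  rw [mul_smul_comm, h1, seqSign, smul_smul, ← Units.val_mul, Int.units_mul_self]
  simp

theorem isSymmetric_schur (mu : ParLen n) : (schur n mu).IsSymmetric := by
  intro σ
  have h := congrArg (rename σ) (alternant_strictSeq mu)
  rw [map_mul, rename_alternant, rename_alternant, alternant_strictSeq, smul_mul_assoc] at h
  have h2 := congrArg (fun p => ((Equiv.Perm.sign σ : ℤˣ) : ℤ) • p) h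
  simp only [smul_smul, ← Units.val_mul, Int.units_mul_self, Units.val_one, one_smul] at h2
  exact (mul_left_cancel₀ alternant_stairZero_ne_zero h2).symm

section

attribute [local instance] MvPolynomial.gradedAlgebra

/-- The cofactor of a nonzero homogeneous polynomial in a homogeneous polynomial is homogeneous. -/
theorem MvPolynomial.IsHomogeneous.of_mul_left {σ : Type*} {a b : MvPolynomial σ ℚ} {d e : ℕ}
    (ha : a.IsHomogeneous d) (h0 : a ≠ 0) (hab : (a * b).IsHomogeneous (d + e)) :
    b.IsHomogeneous e := by
  -- Since a is homogeneous of degree d, the component of ab in degree d + i is a times the i-th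
  -- component of b.
  have key : ∀ i, i ≠ e → homogeneousComponent i b = 0 := by
    intro i hi
    have h := DirectSum.coe_decompose_mul_add_of_left_mem (homogeneousSubmodule σ ℚ) (i := d)
      (j := i) (a := a) (b := b) ha
    have h1 : ∀ (p : MvPolynomial σ ℚ) j,
      (DirectSum.decompose (homogeneousSubmodule σ ℚ) p j : MvPolynomial σ ℚ) =
        homogeneousComponent j p := fun p j => decomposition.decompose'_apply p j
    rw [h1, h1, homogeneousComponent_of_mem ((mem_homogeneousSubmodule _ _).2 hab),
      if_neg (by omega)] at h
    exact (mul_eq_zero.1 h.symm).resolve_left h0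
  have h2 : b = homogeneousComponent e b := by
    conv_lhs => rw [← sum_homogeneousComponent b]
    by_cases he : e ∈ Finset.range (b.totalDegree + 1)
    · exact Finset.sum_eq_single_of_mem e he fun i _ hi => key i hi
    · rw [homogeneousComponent_eq_zero e b (by simpa using he)]
      refine Finset.sum_eq_zero fun i hi => key i ?_
      rintro rfl
      exact he hi
  rw [h2]
  exact homogeneousComponent_isHomogeneous e b

end

theorem isHomogeneous_schur (mu : ParLen n) : (schur n mu).IsHomogeneous mu.1.card := by
  refine (isHomogeneous_alternant (stairZero n)).of_mul_left alternant_stairZero_ne_zero ?_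
  rw [← alternant_strictSeq, add_comm, ← ParLen.sum_strictSeq]
  exact isHomogeneous_alternant _

/-- After multiplication by a_δ, the coefficient of x^{μ+δ} isolates the coefficient of s_μ. -/
theorem linearIndependent_schur (n : ℕ) : LinearIndependent ℚ (schur n) := by
  rw [linearIndependent_iff]
  intro c hc
  ext mu
  have h := congrArg (fun p => coeff (Finsupp.equivFunOnFinite.symm mu.strictSeq)
    (alternant n (stairZero n) * p)) hc
  simp only [Finsupp.linearCombination_apply, Finsupp.sum, Finset.mul_sum, mul_smul_comm,
    ← alternant_strictSeq, coeff_sum, coeff_smul, mul_zero, coeff_zero,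
    coeff_alternant (ParLen.strictAnti_strictSeq _) mu.strictAnti_strictSeq,
    smul_eq_mul, mul_ite, mul_one] at h
  rw [Finset.sum_eq_single mu] at h
  · simpa using h
  · intro x _ hx
    rw [if_neg]
    exact fun h => hx (ParLen.strictSeq_injective h)
  · intro hmu
    simpa using hmu

/-- Symmetric homogeneous polynomials are combinations of Schur polynomials of the same degree. -/
theorem mem_span_schur {f : MvPolynomial (Fin n) ℚ} {d : ℕ} (hs : f.IsSymmetric)
    (hf : f.IsHomogeneous d) :
    f ∈ Submodule.span ℚ (schur n '' {mu | mu.1.card = d}) := by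
  -- Because f is symmetric, a_δ f is the antisymmetrization of x^δ f. Each monomial of f then
  -- yields 0 (repeated exponents) or ±a_δ s_μ (after sorting).
  have h1 : alternant n (stairZero n) * f =
      ∑ m ∈ f.support, coeff m f • alternant n (stairZero n + ⇑m) := by
    rw [← antisymmetrize_prod, ← antisymmetrize_mul hs]
    conv_lhs => rw [f.as_sum]
    rw [Finset.mul_sum, map_sum]
    refine Finset.sum_congr rfl fun m _ => ?_
    rw [prod_X_pow_eq_monomial, monomial_mul, one_mul, antisymmetrize_monomial]
    rfl
  have h2 : ∀ m ∈ f.support, ∃ g ∈ Submodule.span ℚ (schur n '' {mu | mu.1.card = d}),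
      alternant n (stairZero n + ⇑m) = alternant n (stairZero n) * g := by
    intro m hm
    by_cases hinj : Function.Injective (stairZero n + ⇑m)
    · let u : DistinctSeq n := ⟨stairZero n + ⇑m, hinj⟩
      suffices hcard : (ParLen.ofSeq u).1.card = d from ⟨_, zsmul_mem (Submodule.subset_span
        (Set.mem_image_of_mem (schur n) hcard)) _, alternant_distinctSeq u⟩
      have h3 := ParLen.sum_strictSeq (ParLen.ofSeq u)
      simp only [ParLen.strictSeq_ofSeq] at h3
      rw [Equiv.sum_comp (sortPerm u) (stairZero n + ⇑m)] at h3
      have h4 : ∑ i, m i = d := by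
        rw [hf.degree_eq_sum_deg_support hm]
        exact (Finset.sum_subset (Finset.subset_univ _) (by simp)).symm
      simp only [Pi.add_apply, Finset.sum_add_distrib, h4] at h3
      omega
    · exact ⟨0, zero_mem _, by rw [alternant_eq_zero hinj, mul_zero]⟩
  choose! g hg hga using h2
  have h5 : f = ∑ m ∈ f.support, coeff m f • g m := by
    apply mul_left_cancel₀ (alternant_stairZero_ne_zero (n := n))
    rw [h1, Finset.mul_sum]
    refine Finset.sum_congr rfl fun m hm => ?_
    rw [hga m hm, mul_smul_comm]
  rw [h5]
  exact Submodule.sum_mem _ fun m hm => Submodule.smul_mem _ _ (hg m hm)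

/-- The expansion of `s_μ s_ν`, with finitely supported Littlewood--Richardson coefficients. -/
theorem exists_finsupp_lrCoeff (mu nu : ParLen n) :
    ∃ c : ParLen n →₀ ℚ, (∀ lam, c lam = lrCoeff n lam mu nu) ∧
      (∀ lam ∈ c.support, lam.1.card = mu.1.card + nu.1.card) ∧
      schur n mu * schur n nu = Finsupp.linearCombination ℚ (schur n) c := by
  have h := mem_span_schur ((isSymmetric_schur mu).mul (isSymmetric_schur nu))
    ((isHomogeneous_schur mu).mul (isHomogeneous_schur nu))
  rw [Finsupp.mem_span_image_iff_linearCombination] at h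
  obtain ⟨c, hc, hcl⟩ := h
  -- The chosen expansion behind `lrCoeff` must agree with the homogeneous one `c`, by linear
  -- independence; this gives control of its support.
  have h1 := Classical.epsilon_spec (p := fun c : ParLen n →₀ ℚ =>
    schur n mu * schur n nu = Finsupp.linearCombination ℚ (schur n) c) ⟨c, hcl.symm⟩
  have h2 := linearIndependent_schur n (h1.symm.trans hcl.symm)
  refine ⟨c, fun lam => ?_, fun lam hlam => ?_, hcl.symm⟩
  · rw [lrCoeff, h2]
  · exact (Finsupp.mem_supported _ _).1 hc hlam

theorem lrCoeff_eq_zero {lam mu nu : ParLen n} (h : lam.1.card ≠ mu.1.card + nu.1.card) :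
    lrCoeff n lam mu nu = 0 := by
  obtain ⟨c, hc, hsupp, -⟩ := exists_finsupp_lrCoeff mu nu
  rw [← hc]
  by_contra h0
  exact h (hsupp lam (Finsupp.mem_support_iff.2 h0))

theorem schur_mul_schur {mu nu : ParLen n} {s : Finset (ParLen n)}
    (hs : ∀ lam : ParLen n, lam.1.card = mu.1.card + nu.1.card → lam ∈ s) :
    schur n mu * schur n nu = ∑ lam ∈ s, lrCoeff n lam mu nu • schur n lam := by
  obtain ⟨c, hc, hsupp, h⟩ := exists_finsupp_lrCoeff mu nu
  rw [h, Finsupp.linearCombination_apply,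
    Finsupp.sum_of_support_subset c (fun lam hlam => hs lam (hsupp lam hlam)) _ (by simp)]
  exact Finset.sum_congr rfl fun lam _ => by rw [hc]

/-! ### Invertibility of the Kostka matrix. -/

theorem MvPolynomial.IsSymmetric.coeff_comp_perm {f : MvPolynomial (Fin n) ℚ} (hf : f.IsSymmetric)
    (al : Fin n → ℕ) (σ : Equiv.Perm (Fin n)) :
    coeff (Finsupp.equivFunOnFinite.symm (al ∘ σ)) f =
      coeff (Finsupp.equivFunOnFinite.symm al) f := by
  rw [← coeff_rename_mapDomain σ σ.injective f, hf σ]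
  congr 1
  ext i
  rw [← Finsupp.equivMapDomain_eq_mapDomain, Finsupp.equivMapDomain_apply]
  simp

/-- A symmetric polynomial is determined by its coefficients at partitions. -/
theorem MvPolynomial.IsSymmetric.eq_zero {f : MvPolynomial (Fin n) ℚ} (hf : f.IsSymmetric)
    (h : ∀ mu : ParLen n,
      coeff (Finsupp.equivFunOnFinite.symm fun i : Fin n => mu.1.rowLen i) f = 0) : f = 0 := by
  ext m
  have hanti : Antitone (m ∘ Tuple.sort fun i => OrderDual.toDual (m i)) := fun i j hij =>
    Tuple.monotone_sort (fun i => OrderDual.toDual (m i)) hij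
  have h1 := h (ParLen.ofAntitone _ hanti)
  simp only [ParLen.rowLen_ofAntitone] at h1
  have h2 := hf.coeff_comp_perm m (Tuple.sort fun i => OrderDual.toDual (m i))
  rw [show (fun i => (⇑m ∘ ⇑(Tuple.sort fun i => OrderDual.toDual (m i))) i) =
    ⇑m ∘ ⇑(Tuple.sort fun i => OrderDual.toDual (m i)) from rfl, h2] at h1
  simpa using h1

/-- A partition of `k` as a partition of length at most `k`. -/
def ParSize.toParLen {k : ℕ} (mu : ParSize k) : ParLen k :=
  ⟨mu.1, mu.1.colLen_le_card.trans mu.2.le⟩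

/-- A vector w in the left kernel gives a combination ∑ w_λ s_λ whose coefficients at all partitions
vanish: at those of size k by assumption, at the others by homogeneity. It is therefore zero, and
independence gives w = 0. -/
theorem isUnit_kostkaBlock (k : ℕ) : IsUnit (kostkaBlock k) := by
  rw [← Matrix.vecMul_injective_iff_isUnit]
  change Function.Injective (kostkaBlock k).vecMulLinear
  rw [injective_iff_map_eq_zero]
  intro w hw
  have hsum : ∑ lam, w lam • schur k (ParSize.toParLen lam) = 0 := by
    refine IsSymmetric.eq_zero ?_ fun mu => ?_
    · rw [← mem_symmetricSubalgebra]
      exact Subalgebra.sum_mem _ fun lam _ => Subalgebra.smul_mem _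
        ((mem_symmetricSubalgebra _).2 (isSymmetric_schur _)) _
    · rw [coeff_sum]
      by_cases hmu : mu.1.card = k
      · have := congrFun hw ⟨mu.1, hmu⟩
        simpa [Matrix.vecMul, dotProduct, kostkaBlock, kostka, ParSize.toParLen] using this
      · refine Finset.sum_eq_zero fun lam _ => ?_
        rw [coeff_smul, (isHomogeneous_schur _).coeff_eq_zero, smul_zero]
        rw [Finsupp.degree_eq_sum]
        simp only [Finsupp.equivFunOnFinite_symm_apply_apply]
        rw [← ParLen.card_eq_sum]
        exact fun h => hmu (h.trans lam.2)
  have hli := (linearIndependent_schur k).comp (ParSize.toParLen (k := k))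
    fun a b h => Subtype.ext (congrArg (fun x : ParLen k => x.1) h)
  ext lam
  exact Fintype.linearIndependent_iff.1 hli w hsum lam

/-! ### Strips and the Pieri rule. -/

theorem alternant_mul_esymm (al : Fin n → ℕ) (r : ℕ) :
    alternant n al * esymm (Fin n) ℚ r =
      ∑ S ∈ Finset.powersetCard r Finset.univ,
        alternant n (fun i => al i + if i ∈ S then 1 else 0) := by
  rw [← antisymmetrize_prod, ← antisymmetrize_mul (esymm_isSymmetric _ _ r), esymm,
    Finset.mul_sum, map_sum]
  refine Finset.sum_congr rfl fun S _ => ?_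
  rw [← antisymmetrize_prod]
  congr 1
  simp only [pow_add, Finset.prod_mul_distrib]
  congr 1
  simp [Finset.prod_ite_mem, pow_ite]

/-- `mu / nu` has at most one box in every row. -/
def IsVerticalStrip (nu mu : YoungDiagram) : Prop :=
  ∀ i, nu.rowLen i ≤ mu.rowLen i ∧ mu.rowLen i ≤ nu.rowLen i + 1

/-- `mu / nu` has at most one box in every column. -/
def IsHorizontalStrip (nu mu : YoungDiagram) : Prop :=
  ∀ i, mu.rowLen (i + 1) ≤ nu.rowLen i ∧ nu.rowLen i ≤ mu.rowLen i

theorem isVerticalStrip_iff {nu mu : ParLen n} : IsVerticalStrip nu.1 mu.1 ↔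
    ∀ i : Fin n, nu.1.rowLen i ≤ mu.1.rowLen i ∧ mu.1.rowLen i ≤ nu.1.rowLen i + 1 := by
  refine ⟨fun h i => h i, fun h i => ?_⟩
  by_cases hi : i < n
  · exact h ⟨i, hi⟩
  · rw [YoungDiagram.rowLen_eq_zero_iff.2 (mu.2.trans (not_lt.1 hi)),
      YoungDiagram.rowLen_eq_zero_iff.2 (nu.2.trans (not_lt.1 hi))]
    omega

theorem isHorizontalStrip_iff {nu : ParLen n} {mu : ParLen (n + 1)} :
    IsHorizontalStrip nu.1 mu.1 ↔
    ∀ i : Fin n, mu.1.rowLen (i + 1) ≤ nu.1.rowLen i ∧ nu.1.rowLen i ≤ mu.1.rowLen i := by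
  refine ⟨fun h i => h i, fun h i => ?_⟩
  by_cases hi : i < n
  · exact h ⟨i, hi⟩
  · rw [YoungDiagram.rowLen_eq_zero_iff.2 (mu.2.trans (by omega : n + 1 ≤ i + 1)),
      YoungDiagram.rowLen_eq_zero_iff.2 (nu.2.trans (not_lt.1 hi))]
    omega

/-- Consider the first row r of `nu` that misses column i. If column i + 1 of `mu` reached row r,
that row would have grown by at least two boxes. -/
theorem isHorizontalStrip_transpose {nu mu : YoungDiagram} (h : IsVerticalStrip nu mu) :
    IsHorizontalStrip nu.transpose mu.transpose := by
  intro i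
  rw [YoungDiagram.rowLen_transpose, YoungDiagram.rowLen_transpose, YoungDiagram.rowLen_transpose]
  constructor
  · by_contra! hlt
    have h1 := YoungDiagram.mem_iff_lt_rowLen.1 (YoungDiagram.mem_iff_lt_colLen.2 hlt)
    have h2 : ¬ i < nu.rowLen (nu.colLen i) := fun h2 =>
      lt_irrefl _ (YoungDiagram.mem_iff_lt_colLen.1 (YoungDiagram.mem_iff_lt_rowLen.2 h2))
    have := (h (nu.colLen i)).2
    omega
  · by_contra! hlt
    have h1 := YoungDiagram.mem_iff_lt_rowLen.1 (YoungDiagram.mem_iff_lt_colLen.2 hlt)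
    have h2 : ¬ i < mu.rowLen (mu.colLen i) := fun h2 =>
      lt_irrefl _ (YoungDiagram.mem_iff_lt_colLen.1 (YoungDiagram.mem_iff_lt_rowLen.2 h2))
    have := (h (mu.colLen i)).1
    omega

theorem isVerticalStrip_transpose {nu mu : YoungDiagram} (h : IsHorizontalStrip nu mu) :
    IsVerticalStrip nu.transpose mu.transpose := by
  intro i
  rw [YoungDiagram.rowLen_transpose, YoungDiagram.rowLen_transpose]
  constructor
  · by_contra! hlt
    have h1 := YoungDiagram.mem_iff_lt_rowLen.1 (YoungDiagram.mem_iff_lt_colLen.2 hlt)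
    have h2 : ¬ i < mu.rowLen (mu.colLen i) := fun h2 =>
      lt_irrefl _ (YoungDiagram.mem_iff_lt_colLen.1 (YoungDiagram.mem_iff_lt_rowLen.2 h2))
    have := (h (mu.colLen i)).2
    omega
  · by_contra! hlt
    have h1 := YoungDiagram.mem_iff_lt_rowLen.1 (YoungDiagram.mem_iff_lt_colLen.2 hlt)
    have h2 : ¬ i < nu.rowLen (nu.colLen i) := fun h2 =>
      lt_irrefl _ (YoungDiagram.mem_iff_lt_colLen.1 (YoungDiagram.mem_iff_lt_rowLen.2 h2))
    have := (h (nu.colLen i)).1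
    omega

/-- The Pieri rule for elementary symmetric polynomials. -/
theorem schur_mul_esymm (nu : ParLen n) (r : ℕ) (B : Finset (ParLen n))
    (hB : ∀ mu, mu ∈ B ↔ IsVerticalStrip nu.1 mu.1 ∧ mu.1.card = nu.1.card + r) :
    schur n nu * esymm (Fin n) ℚ r = ∑ mu ∈ B, schur n mu := by
  apply mul_left_cancel₀ (alternant_stairZero_ne_zero (n := n))
  rw [← mul_assoc, ← alternant_strictSeq, alternant_mul_esymm, Finset.mul_sum]
  -- A vertical strip is encoded by the set S of rows that receive a box.
  have hseq : ∀ mu : ParLen n, IsVerticalStrip nu.1 mu.1 → ∀ i,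
      mu.strictSeq i = nu.strictSeq i +
        if i ∈ Finset.univ.filter fun i : Fin n => mu.1.rowLen i ≠ nu.1.rowLen i
        then 1 else 0 := by
    intro mu hmu i
    have := hmu i
    simp only [Finset.mem_filter, Finset.mem_univ, true_and, ParLen.strictSeq]
    split_ifs <;> omega
  have hsum : ∀ (mu : ParLen n) (S : Finset (Fin n)),
      (∀ i, mu.strictSeq i = nu.strictSeq i + if i ∈ S then 1 else 0) →
      mu.1.card = nu.1.card + S.card := by
    intro mu S h
    have h1 := mu.sum_strictSeq
    have h2 := nu.sum_strictSeq
    simp only [h, Finset.sum_add_distrib] at h1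
    simp at h1
    omega
  symm
  refine Finset.sum_of_injOn
    (fun mu => Finset.univ.filter fun i : Fin n => mu.1.rowLen i ≠ nu.1.rowLen i) ?_ ?_ ?_ ?_
  · intro mu hmu mu' hmu' h
    apply ParLen.strictSeq_injective
    ext i
    simp only at h
    rw [hseq mu ((hB _).1 hmu).1, hseq mu' ((hB _).1 hmu').1, h]
  · intro mu hmu
    have h1 := (hB _).1 hmu
    have h2 := hsum mu _ (hseq mu h1.1)
    simp only [Finset.mem_coe, Finset.mem_powersetCard]
    exact ⟨Finset.subset_univ _, by omega⟩
  · intro S hS hSB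
    apply alternant_eq_zero
    intro hinj
    apply hSB
    -- Adding 0 or 1 to the entries of a strictly decreasing sequence keeps it weakly decreasing. So
    -- either two entries coincide and the alternant vanishes, or the result is again μ + δ for some
    -- μ.
    have hanti : Antitone fun i => nu.strictSeq i + if i ∈ S then 1 else 0 := by
      intro i j hij
      rcases hij.eq_or_lt with rfl | hlt
      · exact le_rfl
      · have := nu.strictAnti_strictSeq hlt
        simp only
        split_ifs <;> omega
    set mu := ParLen.ofStrictAnti _ (hanti.strictAnti_of_injective hinj) with hmu
    have h1 : ∀ i, mu.strictSeq i = nu.strictSeq i + if i ∈ S then 1 else 0 := fun i => by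
      rw [hmu, ParLen.strictSeq_ofStrictAnti]
    refine ⟨mu, (hB _).2 ⟨isVerticalStrip_iff.2 fun i => ?_, ?_⟩, ?_⟩
    · have := h1 i
      simp only [ParLen.strictSeq] at this
      split_ifs at this <;> omega
    · rw [hsum mu S h1, (Finset.mem_powersetCard.1 hS).2]
    · ext i
      have := h1 i
      simp only [ParLen.strictSeq, Finset.mem_filter, Finset.mem_univ, true_and] at this ⊢
      split_ifs at this with hi <;> simp only [hi, iff_true, iff_false] <;> omega
  · intro mu hmu
    rw [← alternant_strictSeq]
    congr 1
    ext i
    exact hseq mu ((hB _).1 hmu).1 i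

/-! ### The branching rule. -/

theorem Matrix.det_eq_of_forall_col_eq_smul_add_succ {R : Type*} [CommRing R] {k : ℕ}
    {A B : Matrix (Fin (k + 1)) (Fin (k + 1)) R} (c : Fin k → R)
    (hlast : ∀ i, A i (Fin.last k) = B i (Fin.last k))
    (hcast : ∀ (i) (j : Fin k), A i j.castSucc = B i j.castSucc + c j * A i j.succ) :
    A.det = B.det := by
  rw [← Matrix.det_submatrix_equiv_self Fin.revPerm A,
    ← Matrix.det_submatrix_equiv_self Fin.revPerm B]
  refine Matrix.det_eq_of_forall_col_eq_smul_add_pred (fun j => c (Fin.rev j)) ?_ ?_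
  · intro i
    simpa using hlast (Fin.rev i)
  · intro i j
    simpa [Fin.rev_succ, Fin.rev_castSucc] using hcast (Fin.rev i) (Fin.rev j)

/-- The determinant `det (y_i ^ m_j)`. -/
def genVandermonde {R : Type*} [CommRing R] {k : ℕ} (y : Fin k → R) (m : Fin k → ℕ) : R :=
  (Matrix.of fun i j => y i ^ m j).det

/-- Subtracting from each column the multiple of the next one that kills its top entry leaves a
first row supported in the last column. Each entry of the remaining minor is y_i - y_0 times a
geometric sum, and multilinearity in the columns turns these sums into a sum over sequences c
interlacing m. -/
theorem genVandermonde_succ {R : Type*} [CommRing R] {k : ℕ} (y : Fin (k + 1) → R)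
    {m : Fin (k + 1) → ℕ} (hm : StrictAnti m) :
    genVandermonde y m = (∏ i : Fin k, (y 0 - y i.succ)) *
      ∑ c ∈ Fintype.piFinset fun j : Fin k => Finset.Ico (m j.succ) (m j.castSucc),
        y 0 ^ (m (Fin.last k) + ∑ j, (m j.castSucc - 1 - c j)) *
          genVandermonde (fun i => y i.succ) c := by
  have hlt : ∀ j : Fin k, m j.succ < m j.castSucc := fun j => hm Fin.castSucc_lt_succ
  set B : Matrix (Fin (k + 1)) (Fin (k + 1)) R := Matrix.of fun i j =>
    Fin.lastCases (motive := fun _ => R) (y i ^ m (Fin.last k))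
      (fun j => y i ^ m j.castSucc - y 0 ^ (m j.castSucc - m j.succ) * y i ^ m j.succ) j with hB
  have h1 : genVandermonde y m = B.det := by
    refine Matrix.det_eq_of_forall_col_eq_smul_add_succ
      (fun j => y 0 ^ (m j.castSucc - m j.succ)) ?_ ?_
    · intro i
      simp [hB]
    · intro i j
      simp [hB]
  have h2 : B.det = (-1) ^ k * y 0 ^ m (Fin.last k) *
      (B.submatrix Fin.succ Fin.castSucc).det := by
    rw [Matrix.det_succ_row_zero, Fin.sum_univ_castSucc, Finset.sum_eq_zero, zero_add]
    · simp only [Fin.succAbove_last, Fin.val_last]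
      simp [hB]
    · intro j _
      have : B 0 j.castSucc = 0 := by
        simp only [hB, Matrix.of_apply, Fin.lastCases_castSucc]
        rw [← pow_add, Nat.sub_add_cancel (hlt j).le, sub_self]
      rw [this]
      ring
  have h3 : B.submatrix Fin.succ Fin.castSucc = Matrix.of fun i j =>
      (y i.succ - y 0) * ∑ c ∈ Finset.Ico (m j.succ) (m j.castSucc),
        y i.succ ^ c * y 0 ^ (m j.castSucc - 1 - c) := by
    ext1 i j
    simp only [Matrix.submatrix_apply, hB, Matrix.of_apply, Fin.lastCases_castSucc]
    obtain ⟨d, hd⟩ := Nat.exists_eq_add_of_lt (hlt j)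
    rw [Finset.sum_Ico_eq_sum_range, hd]
    have h4 := (Commute.all (y i.succ) (y 0)).mul_geom_sum₂ (d + 1)
    have e1 : m j.succ + d + 1 - m j.succ = d + 1 := by omega
    rw [e1, add_assoc, pow_add, mul_comm (y 0 ^ (d + 1)), ← mul_sub, ← h4, mul_left_comm,
      Finset.mul_sum]
    congr 1
    refine Finset.sum_congr rfl fun c hc => ?_
    have e2 : m j.succ + (d + 1) - 1 - (m j.succ + c) = d + 1 - 1 - c := by omega
    rw [e2, pow_add, mul_assoc]
  have h5 : (Matrix.of fun i j : Fin k =>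
      ∑ c ∈ Finset.Ico (m j.succ) (m j.castSucc),
        y i.succ ^ c * y 0 ^ (m j.castSucc - 1 - c)).det =
      ∑ c ∈ Fintype.piFinset fun j : Fin k => Finset.Ico (m j.succ) (m j.castSucc),
        (∏ j, y 0 ^ (m j.castSucc - 1 - c j)) * genVandermonde (fun i => y i.succ) c := by
    rw [← Matrix.det_transpose]
    have h6 := (Matrix.detRowAlternating (n := Fin k) (R := R)).toMultilinearMap.map_sum_finset
      (fun (j : Fin k) (c : ℕ) => fun i : Fin k => y i.succ ^ c * y 0 ^ (m j.castSucc - 1 - c))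
      (fun j => Finset.Ico (m j.succ) (m j.castSucc))
    refine Eq.trans ?_ (h6.trans ?_)
    · change _ = Matrix.det _
      congr 1
      ext1 j i
      simp [Finset.sum_apply]
    · refine Finset.sum_congr rfl fun c _ => ?_
      rw [genVandermonde, ← Matrix.det_transpose, ← Matrix.det_mul_column]
      change Matrix.det _ = _
      congr 1
      ext1 j i
      simp [mul_comm]
  have h8 : (B.submatrix Fin.succ Fin.castSucc).det = (∏ i : Fin k, (y i.succ - y 0)) *
      (Matrix.of fun i j : Fin k => ∑ c ∈ Finset.Ico (m j.succ) (m j.castSucc),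
        y i.succ ^ c * y 0 ^ (m j.castSucc - 1 - c)).det := by
    rw [h3, ← Matrix.det_mul_column]
    rfl
  rw [h1, h2, h8, h5, Finset.mul_sum, Finset.mul_sum, Finset.mul_sum]
  refine Finset.sum_congr rfl fun c _ => ?_
  -- The cofactor sign (-1)^k is absorbed by reversing the k differences.
  have h7 : ∏ i : Fin k, (y 0 - y i.succ) = (-1) ^ k * ∏ i : Fin k, (y i.succ - y 0) := by
    have h9 : ∀ i : Fin k, y 0 - y i.succ = -1 * (y i.succ - y 0) := fun i => by ring
    rw [Finset.prod_congr rfl fun i _ => h9 i, Finset.prod_mul_distrib]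
    simp
  rw [h7, pow_add, Finset.prod_pow_eq_pow_sum]
  ring

theorem finSuccEquiv_alternant {k : ℕ} {m : Fin (k + 1) → ℕ} (hm : StrictAnti m) :
    finSuccEquiv ℚ k (alternant (k + 1) m) =
      (∏ i : Fin k, (Polynomial.X - Polynomial.C (X i))) *
      ∑ c ∈ Fintype.piFinset fun j : Fin k => Finset.Ico (m j.succ) (m j.castSucc),
        Polynomial.X ^ (m (Fin.last k) + ∑ j, (m j.castSucc - 1 - c j)) *
          Polynomial.C (alternant k c) := by
  have h1 : finSuccEquiv ℚ k (alternant (k + 1) m) =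
      genVandermonde (fun i => finSuccEquiv ℚ k (X i)) m := by
    rw [alternant_eq_det, AlgEquiv.map_det, genVandermonde]
    congr 1
    ext1 i j
    simp
  have h2 : ∀ c : Fin k → ℕ, genVandermonde
      (fun i : Fin k => (Polynomial.C (X i) : Polynomial (MvPolynomial (Fin k) ℚ))) c =
        Polynomial.C (alternant k c) := by
    intro c
    rw [alternant_eq_det, RingHom.map_det, genVandermonde]
    congr 1
    ext1 i j
    simp
  rw [h1, genVandermonde_succ _ hm]
  simp only [finSuccEquiv_X_zero, finSuccEquiv_X_succ, h2]

/-- Consecutive entries of δ differ by one, so the only interlacing sequence is the shorter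
staircase. -/
theorem finSuccEquiv_alternant_stairZero (k : ℕ) :
    finSuccEquiv ℚ k (alternant (k + 1) (stairZero (k + 1))) =
      (∏ i : Fin k, (Polynomial.X - Polynomial.C (X i))) *
        Polynomial.C (alternant k (stairZero k)) := by
  rw [finSuccEquiv_alternant strictAnti_stairZero, Finset.sum_eq_single (stairZero k)]
  · have h : stairZero (k + 1) (Fin.last k) +
        ∑ j : Fin k, (stairZero (k + 1) j.castSucc - 1 - stairZero k j) = 0 := by
      rw [Finset.sum_eq_zero]
      · simp [stairZero]
      · intro j _
        simp only [stairZero, Fin.val_castSucc]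
        omega
    rw [h, pow_zero, one_mul]
  · intro c hc hne
    refine absurd ?_ hne
    ext j
    have := Fintype.mem_piFinset.1 hc j
    simp only [Finset.mem_Ico, stairZero, Fin.val_castSucc, Fin.val_succ] at this ⊢
    omega
  · intro h
    refine absurd (Fintype.mem_piFinset.2 fun j => ?_) h
    simp only [Finset.mem_Ico, stairZero, Fin.val_castSucc, Fin.val_succ]
    omega

/-- The branching rule for Schur polynomials, in terms of coefficients. -/
theorem coeff_cons_schur {k : ℕ} (mu : ParLen (k + 1)) (b : ℕ) (r : Fin k →₀ ℕ)
    (B : Finset (ParLen k))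
    (hB : ∀ nu, nu ∈ B ↔ IsHorizontalStrip nu.1 mu.1 ∧ mu.1.card = nu.1.card + b) :
    coeff (r.cons b) (schur (k + 1) mu) = ∑ nu ∈ B, coeff r (schur k nu) := by
  classical
  have hfin : {nu : ParLen k | IsHorizontalStrip nu.1 mu.1}.Finite := by
    refine (Set.finite_iUnion (ι := Fin (mu.1.card + 1))
      fun i => ParLen.finite_card_eq (n := k) (i : ℕ)).subset fun nu hnu => ?_
    simp only [Set.mem_iUnion]
    refine ⟨⟨nu.1.card, Nat.lt_succ_of_le ?_⟩, rfl⟩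
    rw [ParLen.card_eq_sum, mu.card_eq_sum, Fin.sum_univ_castSucc]
    exact le_add_of_le_left (Finset.sum_le_sum fun i _ => (hnu i).2)
  set H := hfin.toFinset with hH
  have hmem : ∀ nu, nu ∈ H ↔ IsHorizontalStrip nu.1 mu.1 := fun nu => by simp [hH]
  have hIco : ∀ c : Fin k → ℕ, c ∈ Fintype.piFinset
      (fun j : Fin k => Finset.Ico (mu.strictSeq j.succ) (mu.strictSeq j.castSucc)) →
      StrictAnti c := by
    intro c hc i j hij
    have h1 := Finset.mem_Ico.1 (Fintype.mem_piFinset.1 hc i)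
    have h2 := Finset.mem_Ico.1 (Fintype.mem_piFinset.1 hc j)
    have h3 := mu.strictAnti_strictSeq.antitone (show i.succ ≤ j.castSucc from hij)
    omega
  -- The staircase for k + 1 exceeds that for k by one at each j, so the half-open interval for ν +
  -- δ becomes μ_{j+1} ≤ ν_j ≤ μ_j, the horizontal strip condition.
  have hmemIco : ∀ nu : ParLen k, nu.strictSeq ∈ Fintype.piFinset
      (fun j : Fin k => Finset.Ico (mu.strictSeq j.succ) (mu.strictSeq j.castSucc)) ↔
      nu ∈ H := by
    intro nu
    rw [hmem, isHorizontalStrip_iff, Fintype.mem_piFinset]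
    refine forall_congr' fun i => ?_
    simp only [Finset.mem_Ico, ParLen.strictSeq, stairZero, Fin.val_castSucc, Fin.val_succ]
    omega
  have hexp : ∀ nu ∈ H, mu.strictSeq (Fin.last k) +
      ∑ j : Fin k, (mu.strictSeq j.castSucc - 1 - nu.strictSeq j) + nu.1.card = mu.1.card := by
    intro nu hnu
    rw [ParLen.card_eq_sum, mu.card_eq_sum, Fin.sum_univ_castSucc, add_assoc,
      ← Finset.sum_add_distrib, add_comm]
    congr 1
    · refine Finset.sum_congr rfl fun j _ => ?_
      have := isHorizontalStrip_iff.1 ((hmem nu).1 hnu) j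
      simp only [ParLen.strictSeq, stairZero, Fin.val_castSucc]
      omega
    · simp [ParLen.strictSeq, stairZero]
  -- The factor ∏ (X - x_i) occurs in both alternants and cancels; the exponent of the split-off
  -- variable is the number of removed boxes.
  have key : finSuccEquiv ℚ k (schur (k + 1) mu) = ∑ nu ∈ H,
      Polynomial.X ^ (mu.1.card - nu.1.card) * Polynomial.C (schur k nu) := by
    have h0 : finSuccEquiv ℚ k (alternant (k + 1) (stairZero (k + 1))) ≠ 0 := by
      rw [Ne, EmbeddingLike.map_eq_zero_iff]
      exact alternant_stairZero_ne_zero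
    apply mul_left_cancel₀ h0
    rw [← map_mul, ← alternant_strictSeq, finSuccEquiv_alternant mu.strictAnti_strictSeq,
      finSuccEquiv_alternant_stairZero, mul_assoc, Finset.mul_sum (a := Polynomial.C _)]
    congr 1
    symm
    refine Finset.sum_nbij (fun nu => nu.strictSeq) ?_ ?_ ?_ ?_
    · exact fun nu hnu => (hmemIco nu).2 hnu
    · exact fun _ _ _ _ h => ParLen.strictSeq_injective h
    · intro c hc
      refine ⟨ParLen.ofStrictAnti c (hIco c hc), ?_, ParLen.strictSeq_ofStrictAnti _ _⟩
      rw [Finset.mem_coe, ← hmemIco, ParLen.strictSeq_ofStrictAnti]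
      exact hc
    · intro nu hnu
      have := hexp nu hnu
      rw [alternant_strictSeq, Polynomial.C_mul, mul_left_comm]
      congr 2
      omega
  rw [← finSuccEquiv_coeff_coeff, key, Polynomial.finsetSum_coeff, coeff_sum]
  have hBH : B = H.filter fun nu => b = mu.1.card - nu.1.card := by
    ext nu
    rw [hB, Finset.mem_filter, hmem]
    refine and_congr_right fun h => ?_
    have := hexp nu ((hmem nu).2 h)
    omega
  rw [hBH, Finset.sum_filter]
  refine Finset.sum_congr rfl fun nu _ => ?_
  rw [mul_comm, Polynomial.coeff_C_mul_X_pow]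
  split_ifs <;> simp

/-! ### Schur polynomials of arbitrary diagrams and the dual Cauchy identity. -/

/-- The Schur polynomial in `n` variables of any partition; it is `0` if the length exceeds `n`. -/
def schurDiagram (n : ℕ) (mu : YoungDiagram) : MvPolynomial (Fin n) ℚ :=
  if h : mu.colLen 0 ≤ n then schur n ⟨mu, h⟩ else 0

theorem schurDiagram_coe (mu : ParLen n) : schurDiagram n mu.1 = schur n mu := dif_pos mu.2

theorem schurDiagram_of_lt {mu : YoungDiagram} (h : n < mu.colLen 0) : schurDiagram n mu = 0 :=
  dif_neg (not_le.2 h)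

/-- The partitions of length at most `n` of size `N` with a given property. -/
def parLenFilter (n N : ℕ) (p : YoungDiagram → Prop) : Finset (ParLen n) :=
  ((ParLen.finite_card_eq N).subset
    (t := {mu : ParLen n | p mu.1 ∧ mu.1.card = N}) fun _ h => h.2).toFinset

theorem mem_parLenFilter {N : ℕ} {p : YoungDiagram → Prop} {mu : ParLen n} :
    mu ∈ parLenFilter n N p ↔ p mu.1 ∧ mu.1.card = N := by
  simp [parLenFilter]

open Classical in
-- Terms of length greater than n vanish, so sums can run over all partitions of a given size. Pieri
-- and branching, which involve different numbers of variables, thus share an index set.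
theorem sum_parLenFilter {M : Type*} [AddCommMonoid M] (n N : ℕ) (p : YoungDiagram → Prop)
    (f : YoungDiagram → M) (hf : ∀ mu : YoungDiagram, n < mu.colLen 0 → f mu = 0) :
    ∑ mu ∈ parLenFilter n N p, f mu.1 = ∑ mu : ParSize N, if p mu.1 then f mu.1 else 0 := by
  rw [← Finset.sum_filter]
  refine Finset.sum_bij_ne_zero (fun mu hmu _ => ⟨mu.1, (mem_parLenFilter.1 hmu).2⟩) ?_ ?_ ?_ ?_
  · intro mu hmu _
    simpa using (mem_parLenFilter.1 hmu).1
  · intro mu _ _ nu _ _ h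
    exact Subtype.ext (congrArg (fun x : ParSize N => x.1) h)
  · intro mu hmu h0
    have h : mu.1.colLen 0 ≤ n := by
      by_contra hlt
      exact h0 (hf _ (not_le.1 hlt))
    exact ⟨⟨mu.1, h⟩, mem_parLenFilter.2 ⟨(Finset.mem_filter.1 hmu).2, mu.2⟩, h0, rfl⟩
  · exact fun _ _ _ => rfl

open Classical in
theorem schurDiagram_mul_esymm (nu : YoungDiagram) (r : ℕ) {N : ℕ} (hN : N = nu.card + r) :
    schurDiagram n nu * esymm (Fin n) ℚ r =
      ∑ mu : ParSize N, if IsVerticalStrip nu mu.1 then schurDiagram n mu.1 else 0 := by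
  by_cases h : nu.colLen 0 ≤ n
  · rw [schurDiagram_coe ⟨nu, h⟩, schur_mul_esymm ⟨nu, h⟩ r
      (parLenFilter n N (IsVerticalStrip nu)) (by simp [mem_parLenFilter, hN]),
      ← sum_parLenFilter n N _ _ fun _ => schurDiagram_of_lt]
    exact Finset.sum_congr rfl fun mu _ => (schurDiagram_coe mu).symm
  -- Adding boxes cannot decrease the length, so every term on the right vanishes too.
  · rw [schurDiagram_of_lt (not_le.1 h), zero_mul, Finset.sum_eq_zero]
    intro mu _
    split_ifs with hv
    · refine schurDiagram_of_lt (lt_of_lt_of_le (not_le.1 h) ?_)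
      rw [← YoungDiagram.rowLen_eq_zero_iff]
      have h1 := (hv (mu.1.colLen 0)).1
      rw [YoungDiagram.rowLen_eq_zero_iff.2 le_rfl] at h1
      omega
    · rfl

open Classical in
theorem coeff_cons_schurDiagram {k : ℕ} (mu : YoungDiagram) (b : ℕ) (r : Fin k →₀ ℕ) {N : ℕ}
    (hN : mu.card = N + b) :
    coeff (r.cons b) (schurDiagram (k + 1) mu) =
      ∑ nu : ParSize N, if IsHorizontalStrip nu.1 mu then coeff r (schurDiagram k nu.1) else 0 := by
  by_cases h : mu.colLen 0 ≤ k + 1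
  · rw [schurDiagram_coe ⟨mu, h⟩, coeff_cons_schur ⟨mu, h⟩ b r
      (parLenFilter k N fun nu => IsHorizontalStrip nu mu) (by simp [mem_parLenFilter, hN, eq_comm]),
      ← sum_parLenFilter k N (fun nu => IsHorizontalStrip nu mu)
        (fun nu => coeff r (schurDiagram k nu)) fun nu hnu => by
          rw [schurDiagram_of_lt hnu, coeff_zero]]
    exact Finset.sum_congr rfl fun nu _ => by rw [schurDiagram_coe nu]
  -- Removing a horizontal strip shortens the partition by at most one row, so its length still
  -- exceeds k.
  · rw [schurDiagram_of_lt (not_le.1 h), coeff_zero, Finset.sum_eq_zero]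
    intro nu _
    split_ifs with hv
    · rw [schurDiagram_of_lt, coeff_zero]
      by_contra! hle
      have h1 := (hv k).1
      rw [YoungDiagram.rowLen_eq_zero_iff.2 hle] at h1
      have := YoungDiagram.rowLen_eq_zero_iff.1 (Nat.le_zero.1 h1)
      omega
    · rfl

/-- Conjugation of the partitions of `k`. -/
def ParSize.transposeEquiv (k : ℕ) : ParSize k ≃ ParSize k where
  toFun mu := ⟨mu.1.transpose, by rw [YoungDiagram.card_transpose, mu.2]⟩
  invFun mu := ⟨mu.1.transpose, by rw [YoungDiagram.card_transpose, mu.2]⟩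
  left_inv mu := Subtype.ext (YoungDiagram.transpose_transpose _)
  right_inv mu := Subtype.ext (YoungDiagram.transpose_transpose _)

/-- The coefficients of the dual Cauchy identity: products of elementary symmetric polynomials in
`n` variables are expanded in Schur polynomials of conjugate partitions. -/
theorem prod_esymm_eq_sum (n k : ℕ) (r : Fin k →₀ ℕ) {m : ℕ} (hm : ∑ i, r i = m) :
    ∏ i, esymm (Fin n) ℚ (r i) =
      ∑ lam : ParSize m, coeff r (schurDiagram k lam.1) • schurDiagram n lam.1.transpose := by
  classical
  induction k generalizing m with
  | zero =>
    have hm0 : 0 = m := by simpa using hm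
    subst hm0
    have hbot : ∀ mu : YoungDiagram, mu.card = 0 → mu = ⊥ := by
      intro mu hmu
      ext c
      simp [Finset.card_eq_zero.1 (show mu.cells.card = 0 from hmu)]
    have hcol : (⊥ : YoungDiagram).colLen 0 = 0 :=
      Nat.le_zero.1 (⊥ : YoungDiagram).colLen_le_card
    have hsch : ∀ N, schurDiagram N ⊥ = 1 := by
      intro N
      rw [schurDiagram_coe ⟨⊥, hcol.le.trans (Nat.zero_le N)⟩]
      apply mul_left_cancel₀ (alternant_stairZero_ne_zero (n := N))
      rw [← alternant_strictSeq, mul_one]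
      congr 1
      ext i
      simp [ParLen.strictSeq, YoungDiagram.rowLen_eq_zero_iff, hcol]
    let b : ParSize 0 := ⟨⊥, rfl⟩
    have huniq : ∀ lam : ParSize 0, lam = b := fun lam => Subtype.ext (hbot _ lam.2)
    rw [Finset.sum_eq_single b (fun lam _ h => absurd (huniq lam) h) (by simp)]
    have htr : b.1.transpose = ⊥ := hbot _ (by rw [YoungDiagram.card_transpose, b.2])
    rw [htr, hsch, hsch, Subsingleton.elim r 0]
    simp
  | succ k ih =>
    set N := ∑ i : Fin k, r i.succ with hN
    have hmN : m = N + r 0 := by rw [← hm, Fin.sum_univ_succ, add_comm]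
    rw [Fin.prod_univ_succ, mul_comm]
    have h1 := ih r.tail (m := N) rfl
    simp only [Finsupp.tail_apply] at h1
    rw [h1, Finset.sum_mul]
    have h2 : ∀ lam : ParSize N, (coeff r.tail (schurDiagram k lam.1) •
        schurDiagram n lam.1.transpose) * esymm (Fin n) ℚ (r 0) =
        ∑ mu : ParSize m, (if IsHorizontalStrip lam.1 mu.1 then
          coeff r.tail (schurDiagram k lam.1) else 0) • schurDiagram n mu.1.transpose := by
      intro lam
      rw [smul_mul_assoc, schurDiagram_mul_esymm lam.1.transpose (r 0) (N := m)
        (by rw [YoungDiagram.card_transpose, lam.2, hmN]),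
        ← Equiv.sum_comp (ParSize.transposeEquiv m), Finset.smul_sum]
      refine Finset.sum_congr rfl fun mu _ => ?_
      -- Here Pieri for the conjugates meets branching for the partitions themselves.
      have hiff : IsVerticalStrip lam.1.transpose (ParSize.transposeEquiv m mu).1 ↔
          IsHorizontalStrip lam.1 mu.1 := by
        refine ⟨fun h => ?_, isVerticalStrip_transpose⟩
        have := isHorizontalStrip_transpose h
        simpa [ParSize.transposeEquiv, YoungDiagram.transpose_transpose] using this
      simp only [hiff]
      split_ifs
      · rfl
      · simp
    rw [Finset.sum_congr rfl fun lam _ => h2 lam, Finset.sum_comm]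
    refine Finset.sum_congr rfl fun mu _ => ?_
    rw [← Finset.sum_smul, ← Finsupp.cons_tail r,
      coeff_cons_schurDiagram mu.1 (r 0) r.tail (N := N) (by rw [mu.2, hmN])]
    simp

/-! ### Schur polynomials in terms of products of elementary ones. -/

/-- The product `e_ξ` of elementary symmetric polynomials, for any partition `ξ`. -/
def esymmDiagram (n : ℕ) (xi : YoungDiagram) : MvPolynomial (Fin n) ℚ :=
  (xi.rowLens.map fun r => esymm (Fin n) ℚ r).prod

theorem esymm_eq_zero_of_lt {r : ℕ} (h : n < r) : esymm (Fin n) ℚ r = 0 := by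
  rw [esymm, Finset.powersetCard_eq_empty.2 (by simpa using h), Finset.sum_empty]

theorem esymmDiagram_of_lt {xi : YoungDiagram} (h : n < xi.rowLen 0) : esymmDiagram n xi = 0 := by
  rw [← not_le, YoungDiagram.rowLen_zero_le_iff] at h
  push Not at h
  obtain ⟨r, hr, hlt⟩ := h
  exact List.prod_eq_zero (List.mem_map.2 ⟨r, hr, esymm_eq_zero_of_lt hlt⟩)

theorem esymmDiagram_eq_prod {k : ℕ} (xi : YoungDiagram) (h : xi.colLen 0 ≤ k) :
    esymmDiagram n xi = ∏ i : Fin k, esymm (Fin n) ℚ (xi.rowLen i) := by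
  rw [esymmDiagram, YoungDiagram.rowLens, List.map_map, ← Finset.prod_range
    (fun i => esymm (Fin n) ℚ (xi.rowLen i)), ← Finset.prod_subset (Finset.range_mono h)]
  · rw [← List.prod_toFinset _ List.nodup_range, List.toFinset_range]
    rfl
  · intro i _ hi
    rw [YoungDiagram.rowLen_eq_zero_iff.2 (by simpa using hi), esymm_zero]

/-- This is the dual Cauchy expansion at the exponent ξ, padded by e_0 = 1; the coefficient of x^ξ
in s_λ is the Kostka number. -/
theorem esymmDiagram_eq_sum_kostka {k : ℕ} (xi : ParSize k) :
    esymmDiagram n xi.1 =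
      ∑ lam : ParSize k, kostkaBlock k lam xi • schurDiagram n lam.1.transpose := by
  rw [esymmDiagram_eq_prod xi.1 xi.toParLen.2]
  have h := prod_esymm_eq_sum n k
    (Finsupp.equivFunOnFinite.symm fun i : Fin k => xi.1.rowLen i) (m := k) (by
      have := xi.toParLen.card_eq_sum
      simp only [Finsupp.equivFunOnFinite_symm_apply_apply]
      exact this.symm.trans xi.2)
  simp only [Finsupp.equivFunOnFinite_symm_apply_apply] at h
  rw [h]
  refine Finset.sum_congr rfl fun lam _ => ?_
  rw [show lam.1 = lam.toParLen.1 from rfl, schurDiagram_coe]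
  rfl

/-- The expansion of Schur polynomials in products of elementary symmetric polynomials. -/
theorem schurDiagram_eq_sum_invKostka {k : ℕ} (mu : ParSize k) :
    schurDiagram n mu.1 =
      ∑ eta : ParSize k, invKostka eta.1 mu.1.transpose • esymmDiagram n eta.1 := by
  have hinv : ∀ eta : ParSize k, invKostka eta.1 mu.1.transpose =
      (kostkaBlock k)⁻¹ eta (ParSize.transposeEquiv k mu) := by
    intro eta
    set nu := ParSize.transposeEquiv k mu with hnu
    change invKostka eta.1 nu.1 = _
    obtain ⟨nu, rfl⟩ := nu
    rw [invKostka, dif_pos eta.2]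
  simp only [hinv, esymmDiagram_eq_sum_kostka, Finset.smul_sum, smul_smul]
  rw [Finset.sum_comm]
  simp only [← Finset.sum_smul]
  -- The sum over `eta` is the entry at (λ, μ') of K K⁻¹.
  have hone : ∀ lam : ParSize k, ∑ eta, (kostkaBlock k)⁻¹ eta (ParSize.transposeEquiv k mu) *
      kostkaBlock k lam eta = if lam = ParSize.transposeEquiv k mu then 1 else 0 := by
    intro lam
    have h := Matrix.mul_nonsing_inv (kostkaBlock k)
      ((Matrix.isUnit_iff_isUnit_det _).1 (isUnit_kostkaBlock k))
    have h1 := congrFun (congrFun h lam) (ParSize.transposeEquiv k mu)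
    rw [Matrix.mul_apply, Matrix.one_apply] at h1
    rw [← h1]
    exact Finset.sum_congr rfl fun _ _ => mul_comm _ _
  simp only [hone, ite_smul, one_smul, zero_smul, Finset.sum_ite_eq', Finset.mem_univ, if_true]
  simp [ParSize.transposeEquiv]

/-! ### Unions of partitions -/

/-- The union of two partitions. -/
def YoungDiagram.union (eta zeta : YoungDiagram) : YoungDiagram :=
  YoungDiagram.equivListRowLens.symm
    ⟨(eta.rowLens ++ zeta.rowLens).mergeSort (· ≥ ·), List.sortedGE_mergeSort, fun r hr => by
      rw [List.mem_mergeSort, List.mem_append] at hr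
      exact hr.elim (eta.pos_of_mem_rowLens r) (zeta.pos_of_mem_rowLens r)⟩

theorem YoungDiagram.rowLens_union_perm (eta zeta : YoungDiagram) :
    (eta.union zeta).rowLens.Perm (eta.rowLens ++ zeta.rowLens) := by
  have h := YoungDiagram.equivListRowLens.apply_symm_apply
    ⟨(eta.rowLens ++ zeta.rowLens).mergeSort (· ≥ ·), List.sortedGE_mergeSort, fun r hr => by
      rw [List.mem_mergeSort, List.mem_append] at hr
      exact hr.elim (eta.pos_of_mem_rowLens r) (zeta.pos_of_mem_rowLens r)⟩
  have h1 : (eta.union zeta).rowLens = (eta.rowLens ++ zeta.rowLens).mergeSort (· ≥ ·) :=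
    congrArg Subtype.val h
  rw [h1]
  exact List.mergeSort_perm _ _

theorem isUnion_iff_perm {eta zeta xi : YoungDiagram} :
    IsUnion eta zeta xi ↔ xi.rowLens.Perm (eta.rowLens ++ zeta.rowLens) := by
  simp only [IsUnion, List.perm_iff_count, List.count_append]

/-- A partition is the sorted list of its nonzero parts, so the multiplicities determine it. -/
theorem isUnion_iff_eq_union {eta zeta xi : YoungDiagram} :
    IsUnion eta zeta xi ↔ xi = eta.union zeta := by
  rw [isUnion_iff_perm]
  constructor
  · intro h
    apply YoungDiagram.equivListRowLens.injective
    apply Subtype.ext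
    exact (h.trans (eta.rowLens_union_perm zeta).symm).eq_of_sortedGE xi.rowLens_sorted
      (eta.union zeta).rowLens_sorted
  · rintro rfl
    exact eta.rowLens_union_perm zeta

theorem YoungDiagram.card_union (eta zeta : YoungDiagram) :
    (eta.union zeta).card = eta.card + zeta.card := by
  rw [← rowLens_sum, ← rowLens_sum, ← rowLens_sum, (eta.rowLens_union_perm zeta).sum_eq,
    List.sum_append]

theorem esymmDiagram_union (eta zeta : YoungDiagram) :
    esymmDiagram n (eta.union zeta) = esymmDiagram n eta * esymmDiagram n zeta := by
  rw [esymmDiagram, ((eta.rowLens_union_perm zeta).map _).prod_eq, List.map_append,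
    List.prod_append]
  rfl

/-- The union of two partitions with parts at most `n`. -/
def ParPart.union (eta zeta : ParPart n) : ParPart n :=
  ⟨eta.1.union zeta.1, by
    rw [YoungDiagram.rowLen_zero_le_iff]
    intro r hr
    rw [(eta.1.rowLens_union_perm zeta.1).mem_iff, List.mem_append] at hr
    exact hr.elim (YoungDiagram.rowLen_zero_le_iff.1 eta.2 r)
      (YoungDiagram.rowLen_zero_le_iff.1 zeta.2 r)⟩

theorem ParPart.isUnion_iff {eta zeta xi : ParPart n} :
    IsUnion eta.1 zeta.1 xi.1 ↔ xi = eta.union zeta := by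
  rw [isUnion_iff_eq_union, Subtype.ext_iff]
  rfl

/-! ### Finite sets of partitions and sequences of a given size -/

theorem ParPart.finite_card_eq (k : ℕ) : {mu : ParPart n | mu.1.card = k}.Finite := by
  refine Set.Finite.of_injOn (f := fun mu : ParPart n => mu.1)
    (t := Subtype.val '' (Set.univ : Set (ParSize k))) ?_ ?_ (Set.toFinite _)
  · intro mu hmu
    exact ⟨⟨mu.1, hmu⟩, trivial, rfl⟩
  · exact fun _ _ _ _ h => Subtype.ext h

theorem Set.finite_prod_add_eq {α : Type*} {f : α → ℕ} (hf : ∀ k, {a | f a = k}.Finite) (k : ℕ) :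
    {p : α × α | f p.1 + f p.2 = k}.Finite := by
  have h : {a | f a ≤ k}.Finite :=
    ((Set.finite_Iic k).biUnion fun i _ => hf i).subset fun a ha => by
      simpa using ha
  refine (h.prod h).subset fun p hp => ?_
  have hp' : f p.1 + f p.2 = k := hp
  exact ⟨show f p.1 ≤ k by omega, show f p.2 ≤ k by omega⟩

/-- A sequence of distinct numbers amounts to a partition and a permutation. -/
def seqEquiv (n : ℕ) : DistinctSeq n ≃ ParLen n × Equiv.Perm (Fin n) where
  toFun u := (ParLen.ofSeq u, sortPerm u)
  invFun p := ⟨p.1.strictSeq ∘ p.2.symm,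
    p.1.strictAnti_strictSeq.injective.comp p.2.symm.injective⟩
  left_inv u := by
    apply Subtype.ext
    ext i
    simp [ParLen.strictSeq_ofSeq]
  right_inv p := by
    obtain ⟨mu, σ⟩ := p
    set u : DistinctSeq n := ⟨mu.strictSeq ∘ σ.symm,
      mu.strictAnti_strictSeq.injective.comp σ.symm.injective⟩ with hu
    have h := strictAnti_comp_perm_unique mu.strictAnti_strictSeq (strictAnti_sortPerm u)
      (σ.symm * sortPerm u) rfl
    refine Prod.ext (ParLen.strictSeq_injective ?_) ?_
    · ext i
      rw [ParLen.strictSeq_ofSeq, h.2]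
    · exact (inv_mul_eq_one.1 h.1).symm

theorem DistinctSeq.finite_card_eq (k : ℕ) : {u : DistinctSeq n | (seqShape u).card = k}.Finite := by
  refine Set.Finite.of_injOn (f := seqEquiv n) (t := {mu | mu.1.card = k} ×ˢ Set.univ) ?_
    (seqEquiv n).injective.injOn ((ParLen.finite_card_eq k).prod (Set.toFinite _))
  intro u hu
  exact ⟨hu, trivial⟩

theorem invKostka_eq_zero {lam mu : YoungDiagram} (h : lam.card ≠ mu.card) :
    invKostka lam mu = 0 := dif_neg h

/-- The expansion of a Schur polynomial in `e_η`, over partitions with parts at most `n`. -/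
theorem schurDiagram_eq_sum_parPart (mu : YoungDiagram) (A : Finset (ParPart n))
    (hA : ∀ eta, eta ∈ A ↔ eta.1.card = mu.card) :
    schurDiagram n mu = ∑ eta ∈ A, invKostka eta.1 mu.transpose • esymmDiagram n eta.1 := by
  rw [schurDiagram_eq_sum_invKostka (⟨mu, rfl⟩ : ParSize mu.card)]
  symm
  refine Finset.sum_bij_ne_zero (fun eta heta _ => ⟨eta.1, (hA eta).1 heta⟩) ?_ ?_ ?_ ?_
  · exact fun _ _ _ => Finset.mem_univ _
  · intro eta _ _ zeta _ _ h
    exact Subtype.ext (congrArg (fun x : ParSize mu.card => x.1) h)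
  · intro eta _ h0
    have h : eta.1.rowLen 0 ≤ n := by
      by_contra hlt
      exact h0 (by rw [esymmDiagram_of_lt (not_le.1 hlt), smul_zero])
    exact ⟨⟨eta.1, h⟩, (hA _).2 eta.2, h0, rfl⟩
  · exact fun _ _ _ => rfl

theorem invKostkaSum_eq_zero {xi : ParPart n} {u v : DistinctSeq n}
    (h : xi.1.card ≠ (seqShape u).card + (seqShape v).card) : invKostkaSum n xi u v = 0 := by
  rw [invKostkaSum]
  refine (finsum_congr fun p => ?_).trans finsum_zero
  have hp : xi.1.card = _ := (congrArg YoungDiagram.card (isUnion_iff_eq_union.1 p.2)).trans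
    (YoungDiagram.card_union _ _)
  by_cases h1 : p.1.1.1.card = (seqShape u).card
  · rw [invKostka_eq_zero (lam := p.1.2.1), mul_zero]
    rw [YoungDiagram.card_transpose]
    omega
  · rw [invKostka_eq_zero, zero_mul]
    rwa [YoungDiagram.card_transpose]

/-- Multiply the e-expansions of the two Schur polynomials and collect the products e_η e_ζ =
e_{η∪ζ} by ξ = η ∪ ζ. -/
theorem sum_invKostkaSum (u v : DistinctSeq n) (T : Finset (ParPart n))
    (hT : ∀ xi, xi ∈ T ↔ xi.1.card = (seqShape u).card + (seqShape v).card) :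
    ∑ xi ∈ T, invKostkaSum n xi u v • elemSymm n xi =
      schurDiagram n (seqShape u) * schurDiagram n (seqShape v) := by
  classical
  set A := (ParPart.finite_card_eq (n := n) (seqShape u).card).toFinset
  set B := (ParPart.finite_card_eq (n := n) (seqShape v).card).toFinset
  have hA : ∀ eta, eta ∈ A ↔ eta.1.card = (seqShape u).card := fun eta => by simp [A]
  have hB : ∀ eta, eta ∈ B ↔ eta.1.card = (seqShape v).card := fun eta => by simp [B]
  have h1 : ∀ xi : ParPart n, invKostkaSum n xi u v = ∑ p ∈ A ×ˢ B,
      if xi = p.1.union p.2 then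
        invKostka p.1.1 (seqShape u).transpose * invKostka p.2.1 (seqShape v).transpose else 0 := by
    intro xi
    rw [invKostkaSum, finsum_subtype_eq_finsum_cond
      (f := fun p : ParPart n × ParPart n => invKostka p.1.1 (seqShape u).transpose *
        invKostka p.2.1 (seqShape v).transpose)
      (fun p : ParPart n × ParPart n => IsUnion p.1.1 p.2.1 xi.1), ← Finset.sum_filter]
    refine finsum_cond_eq_sum_of_cond_iff _ fun {p} hp => ?_
    rw [Finset.mem_filter, Finset.mem_product, hA, hB, ParPart.isUnion_iff]
    refine ⟨fun h => ⟨⟨?_, ?_⟩, h⟩, fun h => h.2⟩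
    · by_contra h0
      exact hp (by rw [invKostka_eq_zero, zero_mul]; rwa [YoungDiagram.card_transpose])
    · by_contra h0
      exact hp (by
        rw [invKostka_eq_zero (lam := p.2.1), mul_zero]; rwa [YoungDiagram.card_transpose])
  rw [schurDiagram_eq_sum_parPart _ A hA, schurDiagram_eq_sum_parPart _ B hB,
    Finset.sum_mul_sum, ← Finset.sum_product']
  simp only [h1, Finset.sum_smul]
  rw [Finset.sum_comm]
  refine Finset.sum_congr rfl fun p hp => ?_
  rw [Finset.mem_product, hA, hB] at hp
  simp only [ite_smul, zero_smul]
  rw [Finset.sum_ite_eq', if_pos, smul_mul_smul_comm, ← esymmDiagram_union]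
  · rfl
  · rw [hT, ← hp.1, ← hp.2]
    exact YoungDiagram.card_union _ _

/-! ### Determinants as sums over sequences -/

/-- The signed product of `q_{2u_j+a-(n-j)}`. -/
def seqWeight (n : ℕ) (a : ℤ) (u : DistinctSeq n) : MvPolynomial (Fin n) ℚ :=
  (seqSign u : ℚ) • ∏ j : Fin n, qPoly n (2 * (u.1 j : ℤ) + a - (stairZero n j : ℤ))

theorem elemTerm_eq (a b : ℤ) (xi : ParPart n) (p : DistinctSeq n × DistinctSeq n) :
    elemTerm n a b xi p =
      invKostkaSum n xi p.1 p.2 • (seqWeight n a p.1 * seqWeight n b p.2) := by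
  rw [elemTerm, seqWeight, seqWeight, smul_mul_smul_comm, smul_smul, Finset.prod_mul_distrib]
  congr 1
  push_cast
  ring

/-- With 0-based indices δ_i = n - 1 - i, so -i + j = δ_i - δ_j and the index 2μ_i + D_i - i + j
equals 2(μ+δ)_i + a - δ_j. The sequence u for σ satisfies u_{σ(i)} = (μ+δ)_i and has the sign of σ.
-/
theorem redSchur_eq_sum_seqWeight (mu : ParLen n) (D : Fin n → ℕ) (a : ℤ)
    (hD : ∀ i, (D i : ℤ) = stairZero n i + a) :
    redSchur n (fun i => 2 * mu.1.rowLen i + D i) =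
      ∑ σ : Equiv.Perm (Fin n), seqWeight n a ((seqEquiv n).symm (mu, σ)) := by
  rw [redSchur, ← Matrix.det_transpose, Matrix.det_apply]
  refine Finset.sum_congr rfl fun σ _ => ?_
  have hs : seqSign ((seqEquiv n).symm (mu, σ)) = ((Equiv.Perm.sign σ : ℤˣ) : ℤ) := by
    have h := (seqEquiv n).apply_symm_apply (mu, σ)
    rw [seqSign, show sortPerm ((seqEquiv n).symm (mu, σ)) = σ from congrArg Prod.snd h]
  rw [seqWeight, hs, Int.cast_smul_eq_zsmul, Units.smul_def]
  congr 1
  rw [← Equiv.prod_comp σ (fun j => qPoly n (2 * (((seqEquiv n).symm (mu, σ)).1 j : ℤ) + a -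
    (stairZero n j : ℤ)))]
  refine Finset.prod_congr rfl fun i _ => ?_
  have h1 : ((seqEquiv n).symm (mu, σ)).1 (σ i) = mu.strictSeq i := by simp [seqEquiv]
  rw [h1]
  simp only [Matrix.transpose_apply, Matrix.of_apply, ParLen.strictSeq]
  congr 1
  have h2 := hD i
  have h3 : (stairZero n i : ℤ) = n - 1 - i := by
    have := i.2
    simp only [stairZero]
    omega
  have h4 : (stairZero n (σ i) : ℤ) = n - 1 - (σ i : ℕ) := by
    have := (σ i).2
    simp only [stairZero]
    omega
  push_cast
  rw [h2, h3, h4]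
  ring

/-! ### The identity in each degree -/

/-- A rational scalar passes from the coefficient in x to the polynomial in y, as ring homomorphisms
to a common ring agree on ℚ. -/
theorem RingHom.map_smul_mul {A B R : Type*} [CommRing A] [Algebra ℚ A] [CommRing B]
    [Algebra ℚ B] [CommRing R] (f : A →+* R) (g : B →+* R) (c : ℚ) (a : A) (b : B) :
    f (c • a) * g b = f a * g (c • b) := by
  have h : f (algebraMap ℚ A c) = g (algebraMap ℚ B c) :=
    RingHom.congr_fun (RingHom.ext_rat (f.comp (algebraMap ℚ A)) (g.comp (algebraMap ℚ B))) c
  rw [Algebra.smul_def, Algebra.smul_def, map_mul, map_mul, h]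
  ring

theorem support_lrTerm_subset (D E : Fin n → ℕ) (lam : ParLen n) :
    Function.support (lrTerm n D E lam) ⊆
      {p : ParLen n × ParLen n | p.1.1.card + p.2.1.card = lam.1.card} := by
  intro p hp
  by_contra h
  exact hp (by rw [lrTerm, lrCoeff_eq_zero fun h' => h h'.symm, zero_smul])

theorem support_elemTerm_subset (a b : ℤ) (xi : ParPart n) :
    Function.support (elemTerm n a b xi) ⊆
      {p : DistinctSeq n × DistinctSeq n |
        (seqShape p.1).card + (seqShape p.2).card = xi.1.card} := by
  intro p hp
  by_contra h
  exact hp (by rw [elemTerm_eq, invKostkaSum_eq_zero fun h' => h h'.symm, zero_smul])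

theorem finite_prod_card_eq (k : ℕ) :
    {p : ParLen n × ParLen n | p.1.1.card + p.2.1.card = k}.Finite :=
  Set.finite_prod_add_eq (f := fun mu : ParLen n => mu.1.card) ParLen.finite_card_eq k

theorem finite_prod_seqShape_card_eq (k : ℕ) :
    {p : DistinctSeq n × DistinctSeq n |
      (seqShape p.1).card + (seqShape p.2).card = k}.Finite :=
  Set.finite_prod_add_eq (f := fun u : DistinctSeq n => (seqShape u).card)
    DistinctSeq.finite_card_eq k

/-- For `f` the inclusion of ℚ[x] and `g` the evaluation at y², the right side is the degree-k part
in the y_i² of the product of the two generating functions. -/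
theorem sum_lrTerm_eq {R : Type*} [CommRing R] (f g : MvPolynomial (Fin n) ℚ →+* R)
    (D E : Fin n → ℕ) (k : ℕ) :
    ∑ lam ∈ (ParLen.finite_card_eq (n := n) k).toFinset,
        f (∑ᶠ p : ParLen n × ParLen n, lrTerm n D E lam p) * g (schur n lam) =
      ∑ p ∈ (finite_prod_card_eq (n := n) k).toFinset,
        f (redSchur n (fun i => 2 * p.1.1.rowLen i + D i) *
          redSchur n (fun i => 2 * p.2.1.rowLen i + E i)) *
          g (schur n p.1 * schur n p.2) := by
  have h1 : ∀ lam ∈ (ParLen.finite_card_eq (n := n) k).toFinset,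
      f (∑ᶠ p : ParLen n × ParLen n, lrTerm n D E lam p) * g (schur n lam) =
      ∑ p ∈ (finite_prod_card_eq (n := n) k).toFinset,
        f (redSchur n (fun i => 2 * p.1.1.rowLen i + D i) *
          redSchur n (fun i => 2 * p.2.1.rowLen i + E i)) *
          g (lrCoeff n lam p.1 p.2 • schur n lam) := by
    intro lam hlam
    have hk : lam.1.card = k := by simpa using hlam
    rw [finsum_eq_sum_of_support_subset (s := (finite_prod_card_eq (n := n) k).toFinset) _
      (by rw [Set.Finite.coe_toFinset, ← hk]; exact support_lrTerm_subset D E lam),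
      map_sum, Finset.sum_mul]
    refine Finset.sum_congr rfl fun p _ => ?_
    rw [lrTerm, RingHom.map_smul_mul]
  rw [Finset.sum_congr rfl h1, Finset.sum_comm]
  refine Finset.sum_congr rfl fun p hp => ?_
  have hk : p.1.1.card + p.2.1.card = k := by simpa using hp
  rw [← Finset.mul_sum, ← map_sum, schur_mul_schur (fun lam hlam => ?_)]
  simpa using hlam.trans hk

theorem sum_elemTerm_eq {R : Type*} [CommRing R] (f g : MvPolynomial (Fin n) ℚ →+* R)
    (a b : ℤ) (k : ℕ) :
    ∑ xi ∈ (ParPart.finite_card_eq (n := n) k).toFinset,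
        f (∑ᶠ p : DistinctSeq n × DistinctSeq n, elemTerm n a b xi p) * g (elemSymm n xi) =
      ∑ p ∈ (finite_prod_seqShape_card_eq (n := n) k).toFinset,
        f (seqWeight n a p.1 * seqWeight n b p.2) *
          g (schur n (ParLen.ofSeq p.1) * schur n (ParLen.ofSeq p.2)) := by
  have h1 : ∀ xi ∈ (ParPart.finite_card_eq (n := n) k).toFinset,
      f (∑ᶠ p : DistinctSeq n × DistinctSeq n, elemTerm n a b xi p) * g (elemSymm n xi) =
      ∑ p ∈ (finite_prod_seqShape_card_eq (n := n) k).toFinset,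
        f (seqWeight n a p.1 * seqWeight n b p.2) *
          g (invKostkaSum n xi p.1 p.2 • elemSymm n xi) := by
    intro xi hxi
    have hk : xi.1.card = k := by simpa using hxi
    rw [finsum_eq_sum_of_support_subset (s := (finite_prod_seqShape_card_eq (n := n) k).toFinset) _
      (by rw [Set.Finite.coe_toFinset, ← hk]; exact support_elemTerm_subset a b xi),
      map_sum, Finset.sum_mul]
    refine Finset.sum_congr rfl fun p _ => ?_
    rw [elemTerm_eq, RingHom.map_smul_mul]
  rw [Finset.sum_congr rfl h1, Finset.sum_comm]
  refine Finset.sum_congr rfl fun p hp => ?_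
  have hk : (seqShape p.1).card + (seqShape p.2).card = k := by simpa using hp
  rw [← Finset.mul_sum, ← map_sum, sum_invKostkaSum p.1 p.2 _ (fun xi => by simp [hk]),
    ← schurDiagram_coe, ← schurDiagram_coe]
  rfl

theorem sum_seqWeight_eq {R : Type*} [CommRing R] (f g : MvPolynomial (Fin n) ℚ →+* R)
    (D E : Fin n → ℕ) (a b : ℤ) (hD : ∀ i, (D i : ℤ) = stairZero n i + a)
    (hE : ∀ i, (E i : ℤ) = stairZero n i + b) (k : ℕ) :
    ∑ p ∈ (finite_prod_seqShape_card_eq (n := n) k).toFinset,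
        f (seqWeight n a p.1 * seqWeight n b p.2) *
          g (schur n (ParLen.ofSeq p.1) * schur n (ParLen.ofSeq p.2)) =
      ∑ p ∈ (finite_prod_card_eq (n := n) k).toFinset,
        f (redSchur n (fun i => 2 * p.1.1.rowLen i + D i) *
          redSchur n (fun i => 2 * p.2.1.rowLen i + E i)) *
          g (schur n p.1 * schur n p.2) := by
  have h1 : ∀ p : ParLen n × ParLen n,
      f (redSchur n (fun i => 2 * p.1.1.rowLen i + D i) *
          redSchur n (fun i => 2 * p.2.1.rowLen i + E i)) * g (schur n p.1 * schur n p.2) =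
      ∑ s : Equiv.Perm (Fin n) × Equiv.Perm (Fin n),
        f (seqWeight n a ((seqEquiv n).symm (p.1, s.1)) *
          seqWeight n b ((seqEquiv n).symm (p.2, s.2))) * g (schur n p.1 * schur n p.2) := by
    intro p
    rw [redSchur_eq_sum_seqWeight p.1 D a hD, redSchur_eq_sum_seqWeight p.2 E b hE,
      Finset.sum_mul_sum, ← Finset.univ_product_univ, ← Finset.sum_product', map_sum,
      Finset.sum_mul]
  have hofSeq : ∀ q : ParLen n × Equiv.Perm (Fin n),
      ParLen.ofSeq ((seqEquiv n).symm q) = q.1 := fun q =>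
    congrArg Prod.fst ((seqEquiv n).apply_symm_apply q)
  simp only [h1]
  rw [← Finset.sum_product']
  refine Finset.sum_nbij'
    (fun p => ((ParLen.ofSeq p.1, ParLen.ofSeq p.2), (sortPerm p.1, sortPerm p.2)))
    (fun q => ((seqEquiv n).symm (q.1.1, q.2.1), (seqEquiv n).symm (q.1.2, q.2.2))) ?_ ?_ ?_ ?_ ?_
  · intro p hp
    simpa [ParLen.coe_ofSeq] using hp
  · intro q hq
    simpa [← ParLen.coe_ofSeq, hofSeq] using hq
  · intro p _
    exact Prod.ext ((seqEquiv n).symm_apply_apply p.1) ((seqEquiv n).symm_apply_apply p.2)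
  · intro q _
    have h2 := (seqEquiv n).apply_symm_apply (q.1.1, q.2.1)
    have h3 := (seqEquiv n).apply_symm_apply (q.1.2, q.2.2)
    simp only [seqEquiv, Equiv.coe_fn_mk, Prod.mk.injEq] at h2 h3
    simp only [seqEquiv, h2.1, h2.2, h3.1, h3.2]
  · intro p _
    rw [show (ParLen.ofSeq p.1, sortPerm p.1) = seqEquiv n p.1 from rfl,
      show (ParLen.ofSeq p.2, sortPerm p.2) = seqEquiv n p.2 from rfl,
      Equiv.symm_apply_apply, Equiv.symm_apply_apply]

/-! ### Formal sums -/

/-- `f ↦ f(y²)` as a ring homomorphism. -/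
def evalYSqHom (n : ℕ) :
    MvPolynomial (Fin n) ℚ →+* MvPowerSeries (Fin n) (MvPolynomial (Fin n) ℚ) :=
  MvPolynomial.coeToMvPowerSeries.ringHom.comp
    ((MvPolynomial.map MvPolynomial.C).comp (MvPolynomial.expand 2).toRingHom)

theorem coeff_evalYSq_eq_zero {f : MvPolynomial (Fin n) ℚ} {k : ℕ} (hf : f.IsHomogeneous k)
    {d : Fin n →₀ ℕ} (hd : d.degree ≠ 2 * k) : MvPowerSeries.coeff d (evalYSq n f) = 0 := by
  have h : (expand 2 f).IsHomogeneous (2 * k) :=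
    hf.aeval (fun i => X i ^ 2) fun i => isHomogeneous_X_pow i 2
  rw [evalYSq, MvPolynomial.coeff_coe, coeff_map, h.coeff_eq_zero hd, map_zero]

/-- The power series whose coefficient at `y^d` is that of `G ⌊|d|/2⌋`. -/
def evenDegreeSeries (G : ℕ → MvPowerSeries (Fin n) (MvPolynomial (Fin n) ℚ)) :
    MvPowerSeries (Fin n) (MvPolynomial (Fin n) ℚ) :=
  fun d => MvPowerSeries.coeff d (G (d.degree / 2))

/-- Squaring variables doubles degrees, so the coefficient of y^d sees only the finitely many
indices of degree |d|/2. The sum depends on the family only through its homogeneous parts `G`, which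
is how the two sides are compared. -/
theorem hasFormalSum_of_homogeneous {ι : Type} (a p : ι → MvPolynomial (Fin n) ℚ) (deg : ι → ℕ)
    (hp : ∀ i, (p i).IsHomogeneous (deg i)) (T : ℕ → Finset ι) (hT : ∀ k i, i ∈ T k ↔ deg i = k)
    (G : ℕ → MvPowerSeries (Fin n) (MvPolynomial (Fin n) ℚ))
    (hG : ∀ k, ∑ i ∈ T k, MvPowerSeries.C (a i) * evalYSqHom n (p i) = G k) :
    HasFormalSum (fun i => MvPowerSeries.C (a i) * evalYSq n (p i)) (evenDegreeSeries G) := by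
  let : TopologicalSpace (MvPolynomial (Fin n) ℚ) := ⊥
  refine MvPowerSeries.WithPiTopology.hasSum_iff_hasSum_coeff.2 fun d => ?_
  have h0 : MvPowerSeries.coeff d (evenDegreeSeries G) = ∑ i ∈ T (d.degree / 2),
      MvPowerSeries.coeff d (MvPowerSeries.C (a i) * evalYSq n (p i)) := by
    have h1 : MvPowerSeries.coeff d (evenDegreeSeries G) =
      MvPowerSeries.coeff d (G (d.degree / 2)) := rfl
    rw [h1, ← hG, map_sum]
    rfl
  rw [h0]
  refine hasSum_sum_of_ne_finset_zero fun i hi => ?_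
  rw [MvPowerSeries.coeff_C_mul, coeff_evalYSq_eq_zero (hp i), mul_zero]
  rw [hT] at hi
  omega

theorem isHomogeneous_esymm (r : ℕ) : (esymm (Fin n) ℚ r).IsHomogeneous r := by
  refine IsHomogeneous.sum _ _ _ fun S hS => ?_
  have h := IsHomogeneous.prod S (fun i => (X i : MvPolynomial (Fin n) ℚ)) (fun _ => 1)
    fun i _ => isHomogeneous_X _ i
  simpa [(Finset.mem_powersetCard.1 hS).2] using h

theorem isHomogeneous_elemSymm (xi : ParPart n) : (elemSymm n xi).IsHomogeneous xi.1.card := by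
  have h : ∀ l : List ℕ, (l.map fun r => esymm (Fin n) ℚ r).prod.IsHomogeneous l.sum := by
    intro l
    induction l with
    | nil => exact isHomogeneous_one _ _
    | cons r l ih =>
      rw [List.map_cons, List.prod_cons, List.sum_cons]
      exact (isHomogeneous_esymm r).mul ih
  rw [← YoungDiagram.rowLens_sum]
  exact h _

/-- Both finiteness statements and the identity, for shifts `δ + a` and `δ + b`. -/
theorem littlewoodRichardson_sum_eq (D E : Fin n → ℕ) (a b : ℤ)
    (hD : ∀ i, (D i : ℤ) = stairZero n i + a) (hE : ∀ i, (E i : ℤ) = stairZero n i + b) :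
    (∀ lam : ParLen n, (Function.support (lrTerm n D E lam)).Finite) ∧
      (∀ xi : ParPart n, (Function.support (elemTerm n a b xi)).Finite) ∧
      ∃ F : MvPowerSeries (Fin n) (MvPolynomial (Fin n) ℚ),
        HasFormalSum (fun lam : ParLen n =>
          MvPowerSeries.C (∑ᶠ p : ParLen n × ParLen n, lrTerm n D E lam p) *
            evalYSq n (schur n lam)) F ∧
        HasFormalSum (fun xi : ParPart n =>
          MvPowerSeries.C (∑ᶠ p : DistinctSeq n × DistinctSeq n, elemTerm n a b xi p) *
            evalYSq n (elemSymm n xi)) F := by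
  refine ⟨fun lam => (finite_prod_card_eq _).subset (support_lrTerm_subset D E lam),
    fun xi => (finite_prod_seqShape_card_eq _).subset (support_elemTerm_subset a b xi), _,
    hasFormalSum_of_homogeneous _ _ (fun lam : ParLen n => lam.1.card) isHomogeneous_schur
      (fun k => (ParLen.finite_card_eq k).toFinset) (fun k lam => by simp) _
      (sum_lrTerm_eq MvPowerSeries.C (evalYSqHom n) D E),
    hasFormalSum_of_homogeneous _ _ (fun xi : ParPart n => xi.1.card) isHomogeneous_elemSymm
      (fun k => (ParPart.finite_card_eq k).toFinset) (fun k lam => by simp) _ fun k => ?_⟩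
  -- The homogeneous parts of F were fixed by the Littlewood–Richardson side; the other side is
  -- shown to have the same ones.
  rw [sum_elemTerm_eq MvPowerSeries.C (evalYSqHom n), sum_seqWeight_eq _ _ D E a b hD hE]

theorem stairOne_eq (i : Fin n) : (stairOne n i : ℤ) = stairZero n i + 1 := by
  have := i.2
  simp only [stairOne, stairZero]
  omega

end

theorem mainTheorem5 (n : ℕ) (hn : 1 ≤ n) :
    -- all the inner sums are finite
    (∀ xi : ParPart n, {p : ParPart n × ParPart n | IsUnion p.1.1 p.2.1 xi.1}.Finite) ∧
    -- the version with `Δ` and `Δ`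
    ((∀ lam : ParLen n, (Function.support (lrTerm n (stairOne n) (stairOne n) lam)).Finite) ∧
      (∀ xi : ParPart n, (Function.support (elemTerm n 1 1 xi)).Finite) ∧
      ∃ F : MvPowerSeries (Fin n) (MvPolynomial (Fin n) ℚ),
        HasFormalSum (fun lam : ParLen n =>
          MvPowerSeries.C (∑ᶠ p : ParLen n × ParLen n, lrTerm n (stairOne n) (stairOne n) lam p) *
            evalYSq n (schur n lam)) F ∧
        HasFormalSum (fun xi : ParPart n =>
          MvPowerSeries.C (∑ᶠ p : DistinctSeq n × DistinctSeq n, elemTerm n 1 1 xi p) *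
            evalYSq n (elemSymm n xi)) F) ∧
    -- the version with `δ` and `Δ`
    ((∀ lam : ParLen n, (Function.support (lrTerm n (stairZero n) (stairOne n) lam)).Finite) ∧
      (∀ xi : ParPart n, (Function.support (elemTerm n 0 1 xi)).Finite) ∧
      ∃ F : MvPowerSeries (Fin n) (MvPolynomial (Fin n) ℚ),
        HasFormalSum (fun lam : ParLen n =>
          MvPowerSeries.C (∑ᶠ p : ParLen n × ParLen n, lrTerm n (stairZero n) (stairOne n) lam p) *
            evalYSq n (schur n lam)) F ∧
        HasFormalSum (fun xi : ParPart n =>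
          MvPowerSeries.C (∑ᶠ p : DistinctSeq n × DistinctSeq n, elemTerm n 0 1 xi p) *
            evalYSq n (elemSymm n xi)) F) := by
  refine ⟨fun xi => ?_, littlewoodRichardson_sum_eq _ _ 1 1 stairOne_eq stairOne_eq,
    littlewoodRichardson_sum_eq _ _ 0 1 (fun i => (add_zero _).symm) stairOne_eq⟩
  refine (Set.finite_prod_add_eq (f := fun mu : ParPart n => mu.1.card) ParPart.finite_card_eq
    xi.1.card).subset fun p hp => ?_
  exact ((congrArg YoungDiagram.card (isUnion_iff_eq_union.1 hp)).trans
    (YoungDiagram.card_union _ _)).symm
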